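/- Let $n\ge 0$ and let $\mathcal{C}\ell_{0,n}$ be the real Clifford algebra with generators $i_1,\dots,i_n$, $i_j^2=-1$, $i_ji_k=-i_ki_j$ ($j\ne k$), with grade involution $x'$, reversal $x^*$ and Clifford conjugation $\overline{x}=(x')^*$. Let $\$\mathbb{R}^{n+1}=\mathrm{span}_{\mathbb R}(1,i_1,\dots,i_n)$ be the space of paravectors, $\$\Gamma_{n+1}$ the group generated by the invertible paravectors, and $\$\Gamma_{n+1}^{\triangleright}=\$\Gamma_{n+1}\cup\{0\}$. Let $S\$\Gamma_{n+1}$ be the set of Lipschitz spinors: pairs $\kappa=(\xi,\eta)\ne(0,0)$ in $\$\Gamma_{n+1}^{\triangleright}$ with $\xi\overline{\eta}\in\$\mathbb{R}^{n+1}$. Let $SL(2,\$\Gamma_{n+1})$ be the set of matrices $A=\begin{pmatrix}a&b\\c&d\end{pmatrix}$ with $a,b,c,d\in\$\Gamma_{n+1}^{\triangleright}$, $a^*d-c^*b=1$ and $ab^*,cd^*,c^*a,d^*b\in\$\mathbb{R}^{n+1}$. Identify a point $(T,Z;\mathbf X)$ of Minkowski space $\mathbb{R}^{1,n+2}$ (with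 form $(\cdot|\cdot)$ given by $dT^2-dZ^2-dX_0^2-\dots-dX_n^2$) with the matrix $\frac12\begin{pmatrix}T+Z&\mathbf X\\\overline{\mathbf X}&T-Z\end{pmatrix}$, where $\mathbf X=X_0+\sum_j X_ji_j$, and let $\mathbb{H}^{n+2}=\{x : (x|x)=1,\ T>0\}$. Horospheres are the non-empty intersections of $\mathbb{H}^{n+2}$ with affine hyperplanes that have a non-zero null normal vector, and $L\mathrm{Hor}^{n+2}$ is the set of horospheres equipped with an ordered $n$-tuple of (smooth) oriented line fields that are linearly independent at each point. Write $\dagger$ for the transpose with $\overline{\,\cdot\,}$ applied to the entries. Define $\phi_1(\kappa)=\kappa\kappa^\dagger$, with directional derivative $(D_\kappa\phi_1)(v)=\kappa v^\dagger+v\kappa^\dagger$, and $\check\kappa=(\eta',-\xi')$, and let $$\Phi_1(\kappa)=[[\phi_1(\kappa);(D_\kappa\phi_1)(\check\kappa i_1),\dots,(D_\kappa\phi_1)(\check\kappa i_n)]],$$ where $[[p;v_1,\dots,v_n]]$ denotes the tuple of flags $0\subset\mathbb{R}p\subset \mathbb{R}p+\mathbb{R}v_j$ based at $p$, with $(\mathbb{R}p+\mathbb{R}v_j)/\mathbb{R}p$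 oriented by $v_j$. Let $\Phi_2$ send such a multiflag to the horosphere $H=\{x\in\mathbb{H}^{n+2} : (x|p)=1\}$ with the $n$ line fields $q\mapsto T_qH\cap(\mathbb{R}p+\mathbb{R}v_j)$, with the induced orientations, and let $\Phi=\Phi_2\circ\Phi_1$. Then: (1) $SL(2,\$\Gamma_{n+1})$ is a group under matrix multiplication. It acts on $S\$\Gamma_{n+1}$ by $\kappa\mapsto A\kappa$ and on $\mathbb{R}^{1,n+2}$ by $P\mapsto APA^\dagger$. The latter action preserves $\mathbb{H}^{n+2}$ and induces an action on $L\mathrm{Hor}^{n+2}$ (by the map on points of horospheres and by its derivative on line fields). (2) $\kappa\kappa^\dagger\in\mathbb{R}^{1,n+2}$ for every spinor $\kappa$, and $\Phi$ is a well-defined map $S\$\Gamma_{n+1}\to L\mathrm{Hor}^{n+2}$. (3) $\Phi$ is equivariant: $\Phi(A\kappa)=A.\Phi(\kappa)$ for all $A\in SL(2,\$\Gamma_{n+1})$ and $\kappa\in S\$\Gamma_{n+1}$. -/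

import Mathlib

open scoped Matrix Topology ContDiff

noncomputable section

namespace LipSpinor

/-! ### The Clifford algebra, paravectors and the Lipschitz group -/

/-- The negative definite form `-(x₁² + ⋯ + xₙ²)` on `ℝⁿ`. -/
abbrev negForm (n : ℕ) : QuadraticForm ℝ (Fin n → ℝ) :=
  QuadraticMap.weightedSumSquares ℝ (fun _ : Fin n => (-1 : ℝ))

/-- The Clifford algebra `Cl_{0,n}`. The grade involution `x'` is `CliffordAlgebra.involute`,
the reversal `x*` is `CliffordAlgebra.reverse`, and the Clifford conjugation (the composite of
the two) is Mathlib's `star`. -/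
abbrev Cl (n : ℕ) : Type := CliffordAlgebra (negForm n)

/-- The generators `i_1, …, i_n`, with `i_j² = -1`. -/
def gen (n : ℕ) (j : Fin n) : Cl n :=
  CliffordAlgebra.ι (negForm n) (Pi.single j 1)

/-- The basis `1, i_1, …, i_n` of the space of paravectors. -/
def paraBasis (n : ℕ) : Fin (n + 1) → Cl n :=
  Fin.cases 1 (gen n)

/-- The space of paravectors, spanned over `ℝ` by `1, i_1, …, i_n`. -/
def paravectors (n : ℕ) : Submodule ℝ (Cl n) :=
  Submodule.span ℝ (Set.range (paraBasis n))

/-- The real (degree zero) part of an element of the Clifford algebra. The linear isomorphism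
with the exterior algebra sends a product of distinct generators to their wedge product, so
this is the coefficient of `1` in the standard monomial basis. -/
def re (n : ℕ) : Cl n →ₗ[ℝ] ℝ :=
  (ExteriorAlgebra.algebraMapInv (R := ℝ) (M := Fin n → ℝ)).toLinearMap ∘ₗ
    (CliffordAlgebra.equivExterior (negForm n)).toLinearMap

/-- The paravector Lipschitz group: the group generated by the invertible paravectors. -/
def lipschitzGroup (n : ℕ) : Subgroup (Cl n)ˣ :=
  Subgroup.closure {u | (u : Cl n) ∈ paravectors n}

/-- The Lipschitz monoid: the Lipschitz group together with `0`. -/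
def lipschitzMonoid (n : ℕ) : Set (Cl n) :=
  {x | x = 0 ∨ ∃ u ∈ lipschitzGroup n, (u : Cl n) = x}

/-! ### Clifford matrices and Lipschitz spinors -/

/-- The reversal `x*`. -/
def rev {n : ℕ} (x : Cl n) : Cl n := CliffordAlgebra.reverse x

/-- The pseudo-determinant `a* d - c* b`. -/
def pdet {n : ℕ} (A : Matrix (Fin 2) (Fin 2) (Cl n)) : Cl n :=
  rev (A 0 0) * A 1 1 - rev (A 1 0) * A 0 1

/-- The special linear group over the Lipschitz group, as a set of `2 × 2` matrices. -/
def SL2 (n : ℕ) : Set (Matrix (Fin 2) (Fin 2) (Cl n)) :=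
  {A | (∀ i j, A i j ∈ lipschitzMonoid n) ∧
    pdet A = 1 ∧
    A 0 0 * rev (A 0 1) ∈ paravectors n ∧
    A 1 0 * rev (A 1 1) ∈ paravectors n ∧
    rev (A 1 0) * A 0 0 ∈ paravectors n ∧
    rev (A 1 1) * A 0 1 ∈ paravectors n}

/-- The Lipschitz spinors `κ = (ξ, η)`: pairs in the Lipschitz monoid, not both zero, with
`ξ η̄` a paravector. -/
def spinors (n : ℕ) : Set (Fin 2 → Cl n) :=
  {κ | κ ≠ 0 ∧ (∀ i, κ i ∈ lipschitzMonoid n) ∧ κ 0 * star (κ 1) ∈ paravectors n}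

/-- The outer product `κ κ†`. -/
def outer {n : ℕ} (κ : Fin 2 → Cl n) : Matrix (Fin 2) (Fin 2) (Cl n) :=
  Matrix.vecMulVec κ (star κ)

/-- The complement `(η', -ξ')` of `(ξ, η)`. -/
def compl {n : ℕ} (κ : Fin 2 → Cl n) : Fin 2 → Cl n :=
  ![CliffordAlgebra.involute (κ 1), -CliffordAlgebra.involute (κ 0)]

/-- Right multiplication `(ξ, η) x = (ξ x, η x)`. -/
def mulRight {n : ℕ} (κ : Fin 2 → Cl n) (x : Cl n) : Fin 2 → Cl n :=
  fun i => κ i * x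

/-! ### Generalised Minkowski space -/

/-- Minkowski space `ℝ^{1,n+2}` with coordinates `(T, Z; X_0, …, X_n)`. -/
abbrev Mink (n : ℕ) : Type := ℝ × ℝ × (Fin (n + 1) → ℝ)

/-- The Minkowski form `dT² - dZ² - dX_0² - ⋯ - dX_n²`, polarised. -/
def form {n : ℕ} (p q : Mink n) : ℝ :=
  p.1 * q.1 - p.2.1 * q.2.1 - ∑ k, p.2.2 k * q.2.2 k

/-- The paravector Hermitian matrix `½ [T+Z, X; X̄, T-Z]` of a point `(T, Z; X)`. -/
def toMat {n : ℕ} (p : Mink n) : Matrix (Fin 2) (Fin 2) (Cl n) :=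
  (1 / 2 : ℝ) •
    !![algebraMap ℝ (Cl n) (p.1 + p.2.1), ∑ k, p.2.2 k • paraBasis n k;
       star (∑ k, p.2.2 k • paraBasis n k), algebraMap ℝ (Cl n) (p.1 - p.2.1)]

/-- The coordinates `(T, Z; X)` of a paravector Hermitian matrix (the inverse of `toMat` on
such matrices, extended linearly to all matrices): `T = Re(M₁₁ + M₂₂)`, `Z = Re(M₁₁ - M₂₂)` and
`X_k = 2 Re(M₁₂ ē_k)` for the basis `e_k` of the paravectors. -/
def ofMat {n : ℕ} (M : Matrix (Fin 2) (Fin 2) (Cl n)) : Mink n :=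
  (re n (M 0 0 + M 1 1), re n (M 0 0 - M 1 1),
    fun k => 2 * re n (M 0 1 * star (paraBasis n k)))

/-- The conjugation action `S ↦ A S A†` on Minkowski space, in coordinates. -/
def act {n : ℕ} (A : Matrix (Fin 2) (Fin 2) (Cl n)) (p : Mink n) : Mink n :=
  ofMat (A * toMat p * Aᴴ)

/-- The hyperboloid model of `(n+2)`-dimensional hyperbolic space. -/
def hyperboloid (n : ℕ) : Set (Mink n) :=
  {x | form x x = 1 ∧ 0 < x.1}

/-! ### Horospheres with line fields -/

/-- Horospheres in the hyperboloid model: the non-empty intersections of the hyperboloid with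
affine hyperplanes that have a (non-zero) null normal vector. -/
def IsHorosphere {n : ℕ} (H : Set (Mink n)) : Prop :=
  H.Nonempty ∧ ∃ (p : Mink n) (c : ℝ), p ≠ 0 ∧ form p p = 0 ∧
    H = {x | x ∈ hyperboloid n ∧ form x p = c}

/-- The tangent space of `H` at `q`: the velocities at `q` of curves in `H`. -/
def tangentVectors {n : ℕ} (H : Set (Mink n)) (q : Mink n) : Set (Mink n) :=
  {w | ∃ γ : ℝ → Mink n, (∀ᶠ t in 𝓝 (0 : ℝ), γ t ∈ H) ∧ γ 0 = q ∧ HasDerivAt γ w 0}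

/-- Smooth oriented line fields on `H`. An oriented line field is encoded by the set `L` of all
pairs `(q, w)` where `q ∈ H` and `w` is a non-zero vector pointing in the positive direction of
the line at `q`; it is directed by a nowhere vanishing smooth tangent vector field (which, as a
horosphere is a closed submanifold, may be taken to be defined on the ambient space). -/
def IsOrientedLineField {n : ℕ} (H : Set (Mink n)) (L : Set (Mink n × Mink n)) : Prop :=
  ∃ X : Mink n → Mink n, ContDiff ℝ ∞ X ∧
    (∀ q ∈ H, X q ≠ 0 ∧ X q ∈ tangentVectors H q) ∧
    L = {x | x.1 ∈ H ∧ ∃ t : ℝ, 0 < t ∧ x.2 = t • X x.1}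

/-- A set together with `n` families of directions on it. -/
abbrev LineFieldData (n : ℕ) : Type := Set (Mink n) × (Fin n → Set (Mink n × Mink n))

/-- The space of horospheres in hyperbolic `(n+2)`-space carrying an ordered `n`-tuple of
oriented line fields that are linearly independent at every point. -/
def LHor (n : ℕ) : Set (LineFieldData n) :=
  {D | IsHorosphere D.1 ∧ (∀ j, IsOrientedLineField D.1 (D.2 j)) ∧
    ∀ q ∈ D.1, ∀ w : Fin n → Mink n, (∀ j, (q, w j) ∈ D.2 j) → LinearIndependent ℝ w}

/-- The action of a matrix on horospheres with line fields: points move by the action on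
hyperbolic space, and tangent vectors by the derivative of that action. -/
def actLHor {n : ℕ} (A : Matrix (Fin 2) (Fin 2) (Cl n)) (D : LineFieldData n) :
    LineFieldData n :=
  (act A '' D.1, fun j => (fun x => (act A x.1, fderiv ℝ (act A) x.1 x.2)) '' D.2 j)

/-! ### The maps from spinors to multiflags and to horospheres with line fields -/

/-- The basepoint map `κ ↦ κ κ†`, in coordinates. -/
def phi1 {n : ℕ} (κ : Fin 2 → Cl n) : Mink n := ofMat (outer κ)

/-- The oriented flag `[[p, v]]`, i.e. `0 ⊂ ℝp ⊂ ℝp + ℝv` where `(ℝp + ℝv)/ℝp` is oriented by the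
class of `v`. It is encoded by the open half-plane of all vectors of `ℝp + ℝv` whose class in
the quotient is positive. -/
def flag {n : ℕ} (p v : Mink n) : Set (Mink n) :=
  {w | ∃ a b : ℝ, 0 < b ∧ w = a • p + b • v}

/-- A basepoint together with an `n`-tuple of oriented flag planes. -/
abbrev MultiflagData (n : ℕ) : Type := Mink n × (Fin n → Set (Mink n))

/-- The map `Φ₁`, sending `κ` to the multiflag
`[[φ₁(κ); (D_κ φ₁)(κ̌ i_1), …, (D_κ φ₁)(κ̌ i_n)]]`. -/
def Phi1 {n : ℕ} (κ : Fin 2 → Cl n) : MultiflagData n :=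
  (phi1 κ, fun j => flag (phi1 κ) (lineDeriv ℝ phi1 κ (mulRight (compl κ) (gen n j))))

/-- The horosphere `{x ∈ ℍ | (x|p) = 1}` of a point `p` of the light-cone. -/
def phi2 {n : ℕ} (p : Mink n) : Set (Mink n) :=
  {x | x ∈ hyperboloid n ∧ form x p = 1}

/-- The map `Φ₂`: the horosphere of the basepoint, with the line fields obtained at each point
`q` by intersecting the tangent space at `q` with the oriented flag planes. -/
def Phi2 {n : ℕ} (F : MultiflagData n) : LineFieldData n :=
  (phi2 F.1, fun j => {x | x.1 ∈ phi2 F.1 ∧ x.2 ∈ tangentVectors (phi2 F.1) x.1 ∩ F.2 j})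

/-- The map `Φ = Φ₂ ∘ Φ₁`. -/
def Phi {n : ℕ} (κ : Fin 2 → Cl n) : LineFieldData n := Phi2 (Phi1 κ)

end LipSpinor

end

noncomputable section

namespace LipSpinor

variable {n : ℕ}

/-! Two facts carry the proof: Clifford matrices are generated by simple ones, and they act
transitively on spinors. Generation: a matrix in `SL2 n` with invertible upper left entry factors as
lower shear, diagonal, upper shear; otherwise the inversion brings it to this form
(`SL2_induction`). Membership in `SL2 n` says that both columns are spinors and their pairing is `1`
(`mem_SL2_iff`). Each generator preserves spinors and the pairing, and acts on Minkowski space by an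
isometry preserving the future cone. Hence `SL2 n` is a group, and the actions on spinors, on
Minkowski space and on decorated horospheres exist. Transitivity: a spinor `κ` and a real multiple
of its complement are the columns of a matrix in `SL2 n` (`exists_frame`), so `κ = F (1, 0)`.
Everything then reduces to `Φ(F (1, 0)) = F.D` for the decorated horosphere `D` of `(1, 0)`
(`Phi_mulVec_stdSpinor`). Equivariance follows from the action law, and well-definedness from an
explicit description of `D` as a paraboloid with coordinate line fields. The obstacle is that the
complement does not commute with matrices. Two matrices in `SL2 n` with equal first columns have
second columns differing by the first column times a paravector `W` (`exists_snd_column_eq`). In the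
derivative of `κ κ†` this adds the real scalar `W ī_j + i_j W̄`, up to a factor, times the base
point, so the oriented flags are unchanged. -/

/-! ### Paravectors, involutions and the norm -/

theorem sum_smul_paraBasis (x : Fin (n + 1) → ℝ) :
    ∑ k, x k • paraBasis n k =
      algebraMap ℝ (Cl n) (x 0) + CliffordAlgebra.ι (negForm n) (Fin.tail x) := by
  rw [Fin.sum_univ_succ]
  have h : Fin.tail x = ∑ k : Fin n, x k.succ • (Pi.single k 1 : Fin n → ℝ) := by
    ext i
    simp [Fin.tail, Finset.sum_apply, Pi.single_apply]
  rw [h, map_sum]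
  simp [paraBasis, gen, Algebra.algebraMap_eq_smul_one]

theorem mem_paravectors_iff_exists_sum {X : Cl n} :
    X ∈ paravectors n ↔ ∃ x : Fin (n + 1) → ℝ, ∑ k, x k • paraBasis n k = X :=
  Submodule.mem_span_range_iff_exists_fun ℝ

theorem mem_paravectors_iff {X : Cl n} :
    X ∈ paravectors n ↔ ∃ r v, X = algebraMap ℝ (Cl n) r + CliffordAlgebra.ι (negForm n) v := by
  rw [mem_paravectors_iff_exists_sum]
  constructor
  · rintro ⟨x, rfl⟩
    exact ⟨_, _, sum_smul_paraBasis x⟩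
  · rintro ⟨r, v, rfl⟩
    exact ⟨Fin.cons r v, by rw [sum_smul_paraBasis]; simp⟩

theorem algebraMap_mem_paravectors (r : ℝ) : algebraMap ℝ (Cl n) r ∈ paravectors n :=
  mem_paravectors_iff.2 ⟨r, 0, by simp⟩

theorem one_mem_paravectors : (1 : Cl n) ∈ paravectors n := by
  simpa using algebraMap_mem_paravectors (n := n) 1

theorem ι_mem_paravectors (v : Fin n → ℝ) : CliffordAlgebra.ι (negForm n) v ∈ paravectors n :=
  mem_paravectors_iff.2 ⟨0, v, by simp⟩

theorem rev_mul (x y : Cl n) : rev (x * y) = rev y * rev x := CliffordAlgebra.reverse.map_mul x y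
theorem rev_rev (x : Cl n) : rev (rev x) = x := CliffordAlgebra.reverse_reverse x
theorem rev_one : rev (1 : Cl n) = 1 := CliffordAlgebra.reverse.map_one
theorem rev_zero : rev (0 : Cl n) = 0 := map_zero _
theorem rev_add (x y : Cl n) : rev (x + y) = rev x + rev y := map_add _ x y
theorem rev_neg (x : Cl n) : rev (-x) = -rev x := map_neg _ x
theorem rev_smul (r : ℝ) (x : Cl n) : rev (r • x) = r • rev x := map_smul _ r x

theorem star_eq_involute_rev (x : Cl n) : star x = CliffordAlgebra.involute (rev x) := by
  rw [CliffordAlgebra.star_def', rev]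
theorem star_eq_rev_involute (x : Cl n) : star x = rev (CliffordAlgebra.involute x) := by
  rw [CliffordAlgebra.star_def, rev]
theorem rev_star (x : Cl n) : rev (star x) = CliffordAlgebra.involute x := by
  rw [star_eq_rev_involute, rev_rev]
theorem star_rev (x : Cl n) : star (rev x) = CliffordAlgebra.involute x := by
  rw [star_eq_involute_rev, rev_rev]
theorem involute_star (x : Cl n) : CliffordAlgebra.involute (star x) = rev x := by
  rw [star_eq_involute_rev, CliffordAlgebra.involute_involute]
theorem star_involute (x : Cl n) : star (CliffordAlgebra.involute x) = rev x := by
  rw [star_eq_rev_involute, CliffordAlgebra.involute_involute]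

theorem star_real_smul (r : ℝ) (x : Cl n) : star (r • x) = r • star x :=
  CliffordAlgebra.star_smul r x

theorem rev_of_mem {X : Cl n} (hX : X ∈ paravectors n) : rev X = X := by
  obtain ⟨r, v, rfl⟩ := mem_paravectors_iff.1 hX
  simp [rev]

theorem involute_of_mem {X : Cl n} (hX : X ∈ paravectors n) :
    CliffordAlgebra.involute X = star X := by
  rw [star_eq_involute_rev, rev_of_mem hX]

theorem star_mem {X : Cl n} (hX : X ∈ paravectors n) : star X ∈ paravectors n := by
  obtain ⟨r, v, rfl⟩ := mem_paravectors_iff.1 hX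
  refine mem_paravectors_iff.2 ⟨r, -v, ?_⟩
  simp [CliffordAlgebra.star_algebraMap, CliffordAlgebra.star_ι]

theorem involute_mem {X : Cl n} (hX : X ∈ paravectors n) :
    CliffordAlgebra.involute X ∈ paravectors n := by
  rw [involute_of_mem hX]; exact star_mem hX

theorem rev_mem {X : Cl n} (hX : X ∈ paravectors n) : rev X ∈ paravectors n := by
  rwa [rev_of_mem hX]

theorem rev_mem_iff {X : Cl n} : rev X ∈ paravectors n ↔ X ∈ paravectors n :=
  ⟨fun h => by simpa [rev_rev] using rev_mem h, rev_mem⟩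

theorem negForm_apply (v : Fin n → ℝ) : negForm n v = -∑ k, v k * v k := by
  simp [QuadraticMap.weightedSumSquares_apply]

theorem sum_mul_star_sum (x : Fin (n + 1) → ℝ) :
    (∑ k, x k • paraBasis n k) * star (∑ k, x k • paraBasis n k) =
      algebraMap ℝ (Cl n) (∑ k, x k * x k) := by
  rw [sum_smul_paraBasis, star_add, CliffordAlgebra.star_algebraMap, CliffordAlgebra.star_ι,
    Fin.sum_univ_succ, map_add]
  have h : CliffordAlgebra.ι (negForm n) (Fin.tail x) * CliffordAlgebra.ι (negForm n) (Fin.tail x)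
      = -algebraMap ℝ (Cl n) (∑ k : Fin n, x k.succ * x k.succ) := by
    rw [CliffordAlgebra.ι_sq_scalar, negForm_apply, map_neg]; rfl
  have h2 := Algebra.commutes (x 0) (CliffordAlgebra.ι (negForm n) (Fin.tail x))
  rw [add_mul, mul_add, mul_add, mul_neg, mul_neg, h, h2, map_mul]
  abel

theorem exists_mul_star_of_mem {X : Cl n} (hX : X ∈ paravectors n) :
    ∃ r : ℝ, 0 ≤ r ∧ X * star X = algebraMap ℝ (Cl n) r ∧ (X ≠ 0 → 0 < r) := by
  obtain ⟨x, rfl⟩ := mem_paravectors_iff_exists_sum.1 hX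
  have h0 : 0 ≤ ∑ k, x k * x k := Finset.sum_nonneg fun k _ => mul_self_nonneg _
  refine ⟨_, h0, sum_mul_star_sum x, fun h => h0.lt_of_ne' fun h1 => h ?_⟩
  rw [Finset.sum_eq_zero_iff_of_nonneg fun k _ => mul_self_nonneg _] at h1
  exact Finset.sum_eq_zero fun k hk => by rw [mul_self_eq_zero.1 (h1 k hk), zero_smul]

/-- Polarisation: `X`, `Y` and `X + Y` all have real norms. -/
theorem exists_polar_of_mem {X Y : Cl n} (hX : X ∈ paravectors n) (hY : Y ∈ paravectors n) :
    ∃ r : ℝ, X * star Y + Y * star X = algebraMap ℝ (Cl n) r := by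
  obtain ⟨r, -, hr, -⟩ := exists_mul_star_of_mem hX
  obtain ⟨s, -, hs, -⟩ := exists_mul_star_of_mem hY
  obtain ⟨t, -, ht, -⟩ := exists_mul_star_of_mem (add_mem hX hY)
  refine ⟨t - r - s, ?_⟩
  rw [map_sub, map_sub, ← hr, ← hs, ← ht, star_add]
  noncomm_ring

/-! ### The real part and the Euclidean inner product of paravectors -/

theorem re_algebraMap (r : ℝ) : re n (algebraMap ℝ (Cl n) r) = r := by
  simp [re, ExteriorAlgebra.algebraMapInv]

theorem re_ι (v : Fin n → ℝ) : re n (CliffordAlgebra.ι (negForm n) v) = 0 := by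
  simp [re, ExteriorAlgebra.algebraMapInv]

theorem algebraMap_injective : Function.Injective (algebraMap ℝ (Cl n)) :=
  Function.LeftInverse.injective re_algebraMap

/-- The isomorphism with the exterior algebra sends the product to the wedge of `v` and `w` plus a
scalar given by the polar form; the degree zero part sees only the scalar. -/
theorem re_ι_mul_ι (v w : Fin n → ℝ) :
    re n (CliffordAlgebra.ι (negForm n) v * CliffordAlgebra.ι (negForm n) w) =
      -∑ k, v k * w k := by
  have h : re n (CliffordAlgebra.ι (negForm n) v * CliffordAlgebra.ι (negForm n) w) =
      QuadraticMap.associated (R := ℝ) (negForm n) v w := by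
    rw [re, LinearMap.comp_apply, LinearEquiv.coe_coe, CliffordAlgebra.equivExterior,
      CliffordAlgebra.changeFormEquiv_apply, CliffordAlgebra.changeForm_ι_mul_ι]
    simp [ExteriorAlgebra.algebraMapInv]
  rw [h, QuadraticMap.associated_apply, negForm_apply, negForm_apply, negForm_apply]
  simp only [Pi.add_apply, add_mul, mul_add, Finset.sum_add_distrib]
  rw [Finset.sum_congr rfl fun k _ => mul_comm (w k) (v k)]
  generalize ∑ k, v k * w k = a, ∑ k, v k * v k = b, ∑ k, w k * w k = c
  simp
  ring

theorem re_sum_mul_star_sum (x y : Fin (n + 1) → ℝ) :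
    re n ((∑ k, x k • paraBasis n k) * star (∑ k, y k • paraBasis n k)) = ∑ k, x k * y k := by
  rw [sum_smul_paraBasis, sum_smul_paraBasis, star_add, CliffordAlgebra.star_algebraMap,
    CliffordAlgebra.star_ι, Fin.sum_univ_succ, add_mul, mul_add, mul_add, mul_neg, mul_neg,
    ← map_mul, ← Algebra.smul_def, ← Algebra.commutes, ← Algebra.smul_def]
  simp only [map_add, map_neg, map_smul, re_ι, re_algebraMap, re_ι_mul_ι]
  simp [Fin.tail]

theorem re_sum_mul_star_paraBasis (x : Fin (n + 1) → ℝ) (j : Fin (n + 1)) :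
    re n ((∑ k, x k • paraBasis n k) * star (paraBasis n j)) = x j := by
  have h : paraBasis n j = ∑ k, (Pi.single j 1 : Fin (n + 1) → ℝ) k • paraBasis n k := by
    simp [Pi.single_apply]
  conv_lhs => rw [h]
  rw [re_sum_mul_star_sum]
  simp [Pi.single_apply]

/-! ### The Lipschitz group and its action on paravectors -/

/-- With the real numbers `r = XV + V̄X̄` and `s = X̄X` one has `XVX = rX - sV̄`. -/
theorem mul_mul_mem {X V : Cl n} (hX : X ∈ paravectors n) (hV : V ∈ paravectors n) :
    X * V * X ∈ paravectors n := by
  obtain ⟨r, hr⟩ := exists_polar_of_mem hX (star_mem hV)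
  obtain ⟨s, -, hs, -⟩ := exists_mul_star_of_mem (star_mem hX)
  rw [star_star] at hr hs
  have h : X * V * X = r • X - s • star V := by
    rw [Algebra.smul_def, ← hr, Algebra.smul_def, Algebra.commutes, ← hs]
    noncomm_ring
  rw [h]
  exact sub_mem (Submodule.smul_mem _ _ hX) (Submodule.smul_mem _ _ (star_mem hV))

/-- The properties shared by all elements of the Lipschitz group. -/
structure ActsOnParavectors (u : (Cl n)ˣ) : Prop where
  norm : ∃ r : ℝ, 0 < r ∧ star (u : Cl n) = r • (↑u⁻¹ : Cl n)
  conj : ∀ V ∈ paravectors n, (u : Cl n) * V * rev u ∈ paravectors n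
  conj_rev : ∀ V ∈ paravectors n, rev (u : Cl n) * V * u ∈ paravectors n

theorem actsOnParavectors_of_mem {u : (Cl n)ˣ} (hu : (u : Cl n) ∈ paravectors n) :
    ActsOnParavectors u where
  norm := by
    obtain ⟨r, -, hr, hr0⟩ := exists_mul_star_of_mem hu
    refine ⟨r, hr0 u.ne_zero, ?_⟩
    rw [← Units.inv_mul_cancel_left u (star (u : Cl n)), hr, Algebra.smul_def, Algebra.commutes]
  conj V hV := by rw [rev_of_mem hu]; exact mul_mul_mem hu hV
  conj_rev V hV := by rw [rev_of_mem hu]; exact mul_mul_mem hu hV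

theorem star_inv_of_norm {u : (Cl n)ˣ} {r : ℝ} (hr : 0 < r)
    (h : star (u : Cl n) = r • (↑u⁻¹ : Cl n)) : star (↑u⁻¹ : Cl n) = r⁻¹ • (u : Cl n) := by
  have h1 : (↑u⁻¹ : Cl n) = r⁻¹ • star (u : Cl n) := by rw [h, inv_smul_smul₀ hr.ne']
  rw [h1, star_real_smul, star_star]

/-- Since `u⁻¹` is a positive multiple of `ū`, conjugation by `u⁻¹` is, up to scale and the grade
involution, the reversed conjugation by `u`. This exchange is why both conjugations are carried
through the induction. -/
theorem ActsOnParavectors.inv {u : (Cl n)ˣ} (h : ActsOnParavectors u) :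
    ActsOnParavectors u⁻¹ := by
  obtain ⟨r, hr, hu⟩ := h.norm
  have h1 : (↑u⁻¹ : Cl n) = r⁻¹ • star (u : Cl n) := by rw [hu, inv_smul_smul₀ hr.ne']
  refine ⟨⟨r⁻¹, inv_pos.2 hr, by rw [inv_inv]; exact star_inv_of_norm hr hu⟩, fun V hV => ?_,
    fun V hV => ?_⟩
  · have : (↑u⁻¹ : Cl n) * V * rev (↑u⁻¹ : Cl n) = r⁻¹ • r⁻¹ •
        CliffordAlgebra.involute (rev (u : Cl n) * CliffordAlgebra.involute V * (u : Cl n)) := by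
      rw [h1, rev_smul, rev_star, map_mul, map_mul, CliffordAlgebra.involute_involute,
        ← star_eq_involute_rev]
      simp
    rw [this]
    exact Submodule.smul_mem _ _ (Submodule.smul_mem _ _
      (involute_mem (h.conj_rev _ (involute_mem hV))))
  · have : rev (↑u⁻¹ : Cl n) * V * (↑u⁻¹ : Cl n) = r⁻¹ • r⁻¹ •
        CliffordAlgebra.involute ((u : Cl n) * CliffordAlgebra.involute V * rev u) := by
      rw [h1, rev_smul, rev_star, map_mul, map_mul, CliffordAlgebra.involute_involute,
        ← star_eq_involute_rev]
      simp
    rw [this]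
    exact Submodule.smul_mem _ _ (Submodule.smul_mem _ _
      (involute_mem (h.conj _ (involute_mem hV))))

theorem actsOnParavectors {u : (Cl n)ˣ} (hu : u ∈ lipschitzGroup n) : ActsOnParavectors u := by
  induction hu using Subgroup.closure_induction with
  | mem u hu => exact actsOnParavectors_of_mem hu
  | one => exact actsOnParavectors_of_mem (by simpa using one_mem_paravectors)
  | mul x y _ _ hx hy =>
    obtain ⟨r, hr, hxr⟩ := hx.norm
    obtain ⟨s, hs, hys⟩ := hy.norm
    refine ⟨⟨r * s, mul_pos hr hs, ?_⟩, fun V hV => ?_, fun V hV => ?_⟩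
    · rw [Units.val_mul, star_mul, hxr, hys, mul_inv_rev, Units.val_mul, smul_mul_smul_comm,
        mul_comm s r]
    · have := hx.conj _ (hy.conj V hV)
      simpa only [Units.val_mul, rev_mul, mul_assoc] using this
    · have := hy.conj_rev _ (hx.conj_rev V hV)
      simpa only [Units.val_mul, rev_mul, mul_assoc] using this
  | inv x _ hx => exact hx.inv

theorem conj_mem {u : (Cl n)ˣ} (hu : u ∈ lipschitzGroup n) {V : Cl n} (hV : V ∈ paravectors n) :
    (u : Cl n) * V * rev u ∈ paravectors n := (actsOnParavectors hu).conj V hV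

theorem rev_conj_mem {u : (Cl n)ˣ} (hu : u ∈ lipschitzGroup n) {V : Cl n}
    (hV : V ∈ paravectors n) : rev (u : Cl n) * V * u ∈ paravectors n :=
  (actsOnParavectors hu).conj_rev V hV

theorem exists_star_eq_smul_inv {u : (Cl n)ˣ} (hu : u ∈ lipschitzGroup n) :
    ∃ r : ℝ, 0 < r ∧ star (u : Cl n) = r • (↑u⁻¹ : Cl n) := (actsOnParavectors hu).norm

theorem coe_mem_lipschitzMonoid {u : (Cl n)ˣ} (hu : u ∈ lipschitzGroup n) :
    (u : Cl n) ∈ lipschitzMonoid n := Or.inr ⟨u, hu, rfl⟩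

theorem zero_mem_lipschitzMonoid : (0 : Cl n) ∈ lipschitzMonoid n := Or.inl rfl

theorem one_mem_lipschitzMonoid : (1 : Cl n) ∈ lipschitzMonoid n :=
  Or.inr ⟨1, one_mem _, rfl⟩

theorem mul_mem_lipschitzMonoid {x y : Cl n} (hx : x ∈ lipschitzMonoid n)
    (hy : y ∈ lipschitzMonoid n) : x * y ∈ lipschitzMonoid n := by
  rcases hx with rfl | ⟨u, hu, rfl⟩
  · rw [zero_mul]; exact zero_mem_lipschitzMonoid
  rcases hy with rfl | ⟨v, hv, rfl⟩
  · rw [mul_zero]; exact zero_mem_lipschitzMonoid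
  exact Or.inr ⟨u * v, mul_mem hu hv, rfl⟩

theorem paravectors_subset_lipschitzMonoid {X : Cl n} (hX : X ∈ paravectors n) :
    X ∈ lipschitzMonoid n := by
  rcases eq_or_ne X 0 with rfl | h0
  · exact zero_mem_lipschitzMonoid
  obtain ⟨r, -, hr, hpos⟩ := exists_mul_star_of_mem hX
  obtain ⟨s, -, hs, hpos'⟩ := exists_mul_star_of_mem (star_mem hX)
  have hr0 := (hpos h0).ne'
  have hs0 := (hpos' (star_ne_zero.2 h0)).ne'
  rw [star_star] at hs
  have h1 : X * (r⁻¹ • star X) = 1 := by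
    rw [mul_smul_comm, hr, Algebra.algebraMap_eq_smul_one, inv_smul_smul₀ hr0]
  have h2 : (s⁻¹ • star X) * X = 1 := by
    rw [smul_mul_assoc, hs, Algebra.algebraMap_eq_smul_one, inv_smul_smul₀ hs0]
  refine Or.inr ⟨⟨X, r⁻¹ • star X, h1, ?_⟩, Subgroup.subset_closure hX, rfl⟩
  rwa [← left_inv_eq_right_inv h2 h1]

theorem smul_mem_lipschitzMonoid (r : ℝ) {x : Cl n} (hx : x ∈ lipschitzMonoid n) :
    r • x ∈ lipschitzMonoid n := by
  rw [Algebra.smul_def]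
  exact mul_mem_lipschitzMonoid
    (paravectors_subset_lipschitzMonoid (algebraMap_mem_paravectors r)) hx

theorem neg_mem_lipschitzMonoid {x : Cl n} (hx : x ∈ lipschitzMonoid n) :
    -x ∈ lipschitzMonoid n := by
  simpa using smul_mem_lipschitzMonoid (-1) hx

theorem involute_mem_lipschitzMonoid {x : Cl n} (hx : x ∈ lipschitzMonoid n) :
    CliffordAlgebra.involute x ∈ lipschitzMonoid n := by
  rcases hx with rfl | ⟨u, hu, rfl⟩
  · rw [map_zero]; exact zero_mem_lipschitzMonoid
  have h : lipschitzGroup n ≤ (lipschitzGroup n).comap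
      (Units.map (CliffordAlgebra.involute (Q := negForm n) : Cl n →* Cl n)) := by
    rw [lipschitzGroup, Subgroup.closure_le]
    exact fun v hv => Subgroup.subset_closure (involute_mem hv)
  exact Or.inr ⟨_, h hu, rfl⟩

theorem star_mem_lipschitzMonoid {x : Cl n} (hx : x ∈ lipschitzMonoid n) :
    star x ∈ lipschitzMonoid n := by
  rcases hx with rfl | ⟨u, hu, rfl⟩
  · rw [star_zero]; exact zero_mem_lipschitzMonoid
  obtain ⟨r, -, hr⟩ := exists_star_eq_smul_inv hu
  rw [hr]
  exact smul_mem_lipschitzMonoid _ (coe_mem_lipschitzMonoid (inv_mem hu))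

theorem rev_mem_lipschitzMonoid {x : Cl n} (hx : x ∈ lipschitzMonoid n) :
    rev x ∈ lipschitzMonoid n := by
  rw [← involute_star]
  exact involute_mem_lipschitzMonoid (star_mem_lipschitzMonoid hx)

theorem exists_norm {x : Cl n} (hx : x ∈ lipschitzMonoid n) :
    ∃ r : ℝ, 0 ≤ r ∧ x * star x = algebraMap ℝ (Cl n) r ∧ star x * x = algebraMap ℝ (Cl n) r ∧
      (x ≠ 0 → 0 < r) := by
  rcases hx with rfl | ⟨u, hu, rfl⟩
  · exact ⟨0, le_rfl, by simp⟩
  · obtain ⟨r, hr, h⟩ := exists_star_eq_smul_inv hu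
    exact ⟨r, hr.le, by simp [h, Algebra.algebraMap_eq_smul_one],
      by simp [h, Algebra.algebraMap_eq_smul_one], fun _ => hr⟩

/-! ### Spinors as columns of Clifford matrices -/

/-- The two elements are exchanged by `V ↦ u* V u` and its inverse, which preserve paravectors. -/
theorem mul_inv_mem_iff {u : (Cl n)ˣ} (hu : u ∈ lipschitzGroup n) {x : Cl n} :
    x * ↑u⁻¹ ∈ paravectors n ↔ rev (u : Cl n) * x ∈ paravectors n := by
  constructor
  · intro h
    simpa [mul_assoc] using rev_conj_mem hu h
  · intro h
    have h1 := rev_conj_mem (inv_mem hu) h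
    rwa [← mul_assoc, ← rev_mul, Units.mul_inv, rev_one, one_mul] at h1

theorem mul_star_unit_mem_iff {u : (Cl n)ˣ} (hu : u ∈ lipschitzGroup n) {x : Cl n} :
    x * star (u : Cl n) ∈ paravectors n ↔ x * ↑u⁻¹ ∈ paravectors n := by
  obtain ⟨r, hr, h⟩ := exists_star_eq_smul_inv hu
  rw [h, mul_smul_comm, Submodule.smul_mem_iff _ hr.ne']

theorem mul_star_mem_iff {x y : Cl n} (hy : y ∈ lipschitzMonoid n) :
    x * star y ∈ paravectors n ↔ rev y * x ∈ paravectors n := by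
  rcases hy with rfl | ⟨u, hu, rfl⟩
  · simp [rev_zero]
  · rw [mul_star_unit_mem_iff hu, mul_inv_mem_iff hu]

/-- The pairing of spinors whose value on the columns of a matrix is its pseudo-determinant. -/
def pairing (κ v : Fin 2 → Cl n) : Cl n := rev (κ 0) * v 1 - rev (κ 1) * v 0

theorem pdet_eq_pairing (A : Matrix (Fin 2) (Fin 2) (Cl n)) :
    pdet A = pairing (fun i => A i 0) (fun i => A i 1) := rfl

/-- In this form the spinor condition on a column `(a, c)` is literally the condition on `c* a` in
`SL2`. -/
theorem spinors_iff {κ : Fin 2 → Cl n} :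
    κ ∈ spinors n ↔ κ ≠ 0 ∧ (∀ i, κ i ∈ lipschitzMonoid n) ∧ rev (κ 1) * κ 0 ∈ paravectors n :=
  and_congr_right fun _ => and_congr_right fun h => mul_star_mem_iff (h 1)

theorem rev_conj_mem_of_mem {x : Cl n} (hx : x ∈ lipschitzMonoid n) {V : Cl n}
    (hV : V ∈ paravectors n) : rev x * V * x ∈ paravectors n := by
  rcases hx with rfl | ⟨u, hu, rfl⟩
  · simp
  · exact rev_conj_mem hu hV

theorem rev_mul_rev_inv (u : (Cl n)ˣ) : rev (u : Cl n) * rev (↑u⁻¹ : Cl n) = 1 := by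
  rw [← rev_mul, Units.inv_mul, rev_one]

theorem rev_inv_mul_rev (u : (Cl n)ˣ) : rev (↑u⁻¹ : Cl n) * rev (u : Cl n) = 1 := by
  rw [← rev_mul, Units.mul_inv, rev_one]

/-- The triangular decomposition of a Clifford matrix with invertible upper left entry. -/
theorem exists_triangular {u : (Cl n)ˣ} (hu : u ∈ lipschitzGroup n) {b c d : Cl n}
    (hb : b ∈ lipschitzMonoid n) (hac : rev c * u ∈ paravectors n)
    (hbd : rev d * b ∈ paravectors n) (hdet : rev (u : Cl n) * d - rev c * b = 1) :
    ∃ U ∈ paravectors n, ∃ W ∈ paravectors n,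
      b = u * W ∧ c = U * u ∧ d = rev (↑u⁻¹ : Cl n) + U * u * W := by
  have hU : c * ↑u⁻¹ ∈ paravectors n := by
    rw [mul_inv_mem_iff hu, ← rev_mem_iff, rev_mul, rev_rev]
    exact hac
  have hc : c = c * ↑u⁻¹ * u := by simp
  generalize c * ↑u⁻¹ = U at hU hc
  subst hc
  have hd : d = rev (↑u⁻¹ : Cl n) + U * b := by
    have h := congr_arg (fun x => rev (↑u⁻¹ : Cl n) * x) hdet
    simp only [mul_sub, rev_mul, ← mul_assoc, rev_inv_mul_rev, one_mul, mul_one,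
      rev_of_mem hU] at h
    rw [← h]
    abel
  -- From `d = (u*)⁻¹ + U b` one gets `d* b = u⁻¹ b + b* U b`, and the last term is a paravector.
  have hW : ↑u⁻¹ * b ∈ paravectors n := by
    have h := sub_mem hbd (rev_conj_mem_of_mem hb hU)
    rwa [hd, rev_add, rev_rev, rev_mul, rev_of_mem hU, add_mul, add_sub_cancel_right] at h
  refine ⟨U, hU, _, hW, by simp, rfl, ?_⟩
  rw [hd]
  simp [mul_assoc]

/-- A matrix is in `SL2` as soon as its columns are spinors and its pseudo-determinant is `1`. -/
theorem mem_SL2_iff {A : Matrix (Fin 2) (Fin 2) (Cl n)} :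
    A ∈ SL2 n ↔ (fun i => A i 0) ∈ spinors n ∧ (fun i => A i 1) ∈ spinors n ∧ pdet A = 1 := by
  constructor
  · rintro ⟨hM, hdet, -, -, hac, hbd⟩
    refine ⟨spinors_iff.2 ⟨fun h => ?_, fun i => hM i 0, hac⟩,
      spinors_iff.2 ⟨fun h => ?_, fun i => hM i 1, hbd⟩, hdet⟩
    · have h0 : A 0 0 = 0 := congr_fun h 0
      have h1 : A 1 0 = 0 := congr_fun h 1
      simp [pdet, h0, h1, rev_zero] at hdet
    · have h0 : A 0 1 = 0 := congr_fun h 0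
      have h1 : A 1 1 = 0 := congr_fun h 1
      simp [pdet, h0, h1] at hdet
  · rintro ⟨h0, h1, hdet⟩
    obtain ⟨-, hM0, hac⟩ := spinors_iff.1 h0
    obtain ⟨-, hM1, hbd⟩ := spinors_iff.1 h1
    have hM : ∀ i j, A i j ∈ lipschitzMonoid n := fun i j => by
      fin_cases j
      · exact hM0 i
      · exact hM1 i
    suffices h : A 0 0 * rev (A 0 1) ∈ paravectors n ∧ A 1 0 * rev (A 1 1) ∈ paravectors n from
      ⟨hM, hdet, h.1, h.2, hac, hbd⟩
    rw [pdet] at hdet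
    have hb := hM 0 1
    rcases hM 0 0 with ha | ⟨u, hu, ha⟩
    -- If `a = 0` then `-c* b = 1`, so `b = -(c*)⁻¹`; conjugating `d* b` by `c` gives `c d*` up to
    -- sign.
    · rw [ha, rev_zero, zero_mul, zero_sub] at hdet
      refine ⟨by simp [ha], ?_⟩
      rcases hM 1 0 with hc | ⟨v, hv, hc⟩
      · simp [hc]
      · rw [← hc] at hdet ⊢
        have hb' : A 0 1 = -rev (↑v⁻¹ : Cl n) := by
          have h := congr_arg (fun x => rev (↑v⁻¹ : Cl n) * x) hdet
          simp only [mul_neg, ← mul_assoc, rev_inv_mul_rev, one_mul, mul_one] at h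
          rw [← h, neg_neg]
        rw [hb', mul_neg, neg_mem_iff] at hbd
        have h := conj_mem hv hbd
        rwa [mul_assoc, mul_assoc, rev_inv_mul_rev, mul_one] at h
    · rw [← ha] at hac hdet ⊢
      obtain ⟨U, hU, W, hW, hb', hc, hd⟩ := exists_triangular hu hb hac hbd hdet
      rw [hb', hc, hd]
      -- Here `a b* = u W u*` and `c d* = U + U (u W u*) U`.
      constructor
      · rw [rev_mul, rev_of_mem hW, ← mul_assoc]
        exact conj_mem hu hW
      · rw [rev_add, rev_rev, rev_mul, rev_mul, rev_of_mem hU, rev_of_mem hW, mul_add,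
          Units.mul_inv_cancel_right]
        have h := mul_mul_mem hU (conj_mem hu hW)
        simp only [mul_assoc] at h ⊢
        exact add_mem hU h

/-! ### Generators and the group structure -/

/-- The shear by a paravector. -/
def shear (W : Cl n) : Matrix (Fin 2) (Fin 2) (Cl n) := !![1, W; 0, 1]

/-- The diagonal matrix with entries `u` and `(u*)⁻¹`. -/
def diag (u : (Cl n)ˣ) : Matrix (Fin 2) (Fin 2) (Cl n) := !![↑u, 0; 0, rev (↑u⁻¹ : Cl n)]

/-- The matrix of the inversion. -/
def inversion (n : ℕ) : Matrix (Fin 2) (Fin 2) (Cl n) := !![0, 1; -1, 0]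

theorem one_mem_SL2 : (1 : Matrix (Fin 2) (Fin 2) (Cl n)) ∈ SL2 n := by
  refine ⟨fun i j => ?_, by simp [pdet, rev_one, rev_zero], by simp [rev_zero], by simp,
    by simp [rev_zero], by simp⟩
  rw [Matrix.one_apply]
  split_ifs
  exacts [one_mem_lipschitzMonoid, zero_mem_lipschitzMonoid]

theorem neg_one_mem_lipschitzGroup : (-1 : (Cl n)ˣ) ∈ lipschitzGroup n :=
  Subgroup.subset_closure (by simpa using one_mem_paravectors)

theorem exists_diag_neg_one :
    ∃ u ∈ lipschitzGroup n, diag u = (-1 : Matrix (Fin 2) (Fin 2) (Cl n)) := by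
  refine ⟨_, neg_one_mem_lipschitzGroup, ?_⟩
  rw [Matrix.one_fin_two]
  simp [diag, rev_neg, rev_one]

theorem shear_mulVec (W : Cl n) (κ : Fin 2 → Cl n) :
    shear W *ᵥ κ = ![κ 0 + W * κ 1, κ 1] := by
  ext i; fin_cases i <;> simp [shear, Matrix.mulVec, dotProduct]

theorem diag_mulVec (u : (Cl n)ˣ) (κ : Fin 2 → Cl n) :
    diag u *ᵥ κ = ![↑u * κ 0, rev (↑u⁻¹ : Cl n) * κ 1] := by
  ext i; fin_cases i <;> simp [diag, Matrix.mulVec, dotProduct]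

theorem inversion_mulVec (κ : Fin 2 → Cl n) : inversion n *ᵥ κ = ![κ 1, -κ 0] := by
  ext i; fin_cases i <;> simp [inversion, Matrix.mulVec, dotProduct]

theorem pairing_shear {W : Cl n} (hW : W ∈ paravectors n) (κ v : Fin 2 → Cl n) :
    pairing (shear W *ᵥ κ) (shear W *ᵥ v) = pairing κ v := by
  simp only [pairing, shear_mulVec, Matrix.cons_val_zero, Matrix.cons_val_one, rev_add, rev_mul,
    rev_of_mem hW]
  noncomm_ring

theorem pairing_diag (u : (Cl n)ˣ) (κ v : Fin 2 → Cl n) :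
    pairing (diag u *ᵥ κ) (diag u *ᵥ v) = pairing κ v := by
  simp only [pairing, diag_mulVec, Matrix.cons_val_zero, Matrix.cons_val_one, rev_mul, rev_rev]
  rw [mul_assoc, ← mul_assoc (rev (u : Cl n)), rev_mul_rev_inv, mul_assoc,
    Units.inv_mul_cancel_left, one_mul]

theorem pairing_inversion (κ v : Fin 2 → Cl n) :
    pairing (inversion n *ᵥ κ) (inversion n *ᵥ v) = pairing κ v := by
  simp only [pairing, inversion_mulVec, Matrix.cons_val_zero, Matrix.cons_val_one, rev_neg]
  noncomm_ring

theorem shear_mulVec_mem_spinors {W : Cl n} (hW : W ∈ paravectors n) {κ : Fin 2 → Cl n}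
    (hκ : κ ∈ spinors n) : shear W *ᵥ κ ∈ spinors n := by
  obtain ⟨h0, hM, h⟩ := hκ
  obtain ⟨r, -, hr, -⟩ := exists_norm (hM 1)
  have hpar : (κ 0 + W * κ 1) * star (κ 1) ∈ paravectors n := by
    rw [add_mul, mul_assoc, hr, ← Algebra.commutes, ← Algebra.smul_def]
    exact add_mem h (Submodule.smul_mem _ _ hW)
  rw [shear_mulVec]
  refine ⟨fun h' => h0 ?_, fun i => ?_, hpar⟩
  · have h1 : κ 1 = 0 := congr_fun h' 1
    have h2 : κ 0 + W * κ 1 = 0 := congr_fun h' 0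
    ext i
    fin_cases i
    · simpa [h1] using h2
    · exact h1
  · fin_cases i
    -- Sums usually leave the Lipschitz monoid. Here, for invertible `η`, `(ξ + Wη) η⁻¹` is a
    -- paravector, so `ξ + Wη` is a product of two elements of the monoid.
    · rcases hM 1 with h1 | ⟨u, hu, h1⟩
      · simpa [h1] using hM 0
      · rw [← h1, mul_star_unit_mem_iff hu] at hpar
        have := mul_mem_lipschitzMonoid (paravectors_subset_lipschitzMonoid hpar)
          (coe_mem_lipschitzMonoid hu)
        simpa [← h1] using this
    · exact hM 1

theorem diag_mulVec_mem_spinors {u : (Cl n)ˣ} (hu : u ∈ lipschitzGroup n) {κ : Fin 2 → Cl n}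
    (hκ : κ ∈ spinors n) : diag u *ᵥ κ ∈ spinors n := by
  obtain ⟨h0, hM, h⟩ := spinors_iff.1 hκ
  rw [diag_mulVec]
  refine spinors_iff.2 ⟨fun h' => h0 ?_, fun i => ?_, ?_⟩
  · have h1 : ↑u * κ 0 = 0 := congr_fun h' 0
    have h2 : rev (↑u⁻¹ : Cl n) * κ 1 = 0 := congr_fun h' 1
    ext i
    fin_cases i
    · simpa using h1
    · change κ 1 = 0
      have h3 := congr_arg (fun x => rev (u : Cl n) * x) h2
      simpa only [← mul_assoc, rev_mul_rev_inv, one_mul, mul_zero] using h3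
  · fin_cases i
    · exact mul_mem_lipschitzMonoid (coe_mem_lipschitzMonoid hu) (hM 0)
    · exact mul_mem_lipschitzMonoid
        (rev_mem_lipschitzMonoid (coe_mem_lipschitzMonoid (inv_mem hu))) (hM 1)
  · simpa [rev_mul, rev_rev, mul_assoc] using h

theorem inversion_mulVec_mem_spinors {κ : Fin 2 → Cl n} (hκ : κ ∈ spinors n) :
    inversion n *ᵥ κ ∈ spinors n := by
  obtain ⟨h0, hM, h⟩ := hκ
  rw [inversion_mulVec]
  refine ⟨fun h' => h0 ?_, fun i => ?_, ?_⟩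
  · have h1 : κ 1 = 0 := congr_fun h' 0
    have h2 : -κ 0 = 0 := congr_fun h' 1
    ext i
    fin_cases i
    · simpa using h2
    · exact h1
  · fin_cases i
    · exact hM 1
    · exact neg_mem_lipschitzMonoid (hM 0)
  · simpa using star_mem h

/-- By `mem_SL2_iff`, membership depends only on the columns being spinors and on their pairing. -/
theorem mul_mem_SL2_of_generator {g A : Matrix (Fin 2) (Fin 2) (Cl n)}
    (hg : ∀ κ ∈ spinors n, g *ᵥ κ ∈ spinors n)
    (hg' : ∀ κ v, pairing (g *ᵥ κ) (g *ᵥ v) = pairing κ v) (hA : A ∈ SL2 n) :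
    g * A ∈ SL2 n := by
  obtain ⟨h0, h1, hdet⟩ := mem_SL2_iff.1 hA
  refine mem_SL2_iff.2 ⟨hg _ h0, hg _ h1, ?_⟩
  rw [pdet_eq_pairing] at hdet ⊢
  exact (hg' _ _).trans hdet

theorem shear_mul_mem_SL2 {W : Cl n} (hW : W ∈ paravectors n)
    {A : Matrix (Fin 2) (Fin 2) (Cl n)} (hA : A ∈ SL2 n) : shear W * A ∈ SL2 n :=
  mul_mem_SL2_of_generator (fun _ => shear_mulVec_mem_spinors hW) (pairing_shear hW) hA

theorem diag_mul_mem_SL2 {u : (Cl n)ˣ} (hu : u ∈ lipschitzGroup n)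
    {A : Matrix (Fin 2) (Fin 2) (Cl n)} (hA : A ∈ SL2 n) : diag u * A ∈ SL2 n :=
  mul_mem_SL2_of_generator (fun _ => diag_mulVec_mem_spinors hu) (pairing_diag u) hA

theorem inversion_mul_mem_SL2 {A : Matrix (Fin 2) (Fin 2) (Cl n)} (hA : A ∈ SL2 n) :
    inversion n * A ∈ SL2 n :=
  mul_mem_SL2_of_generator (fun _ => inversion_mulVec_mem_spinors) pairing_inversion hA

/-- Induction on Clifford matrices: they are products of shears, diagonal matrices and the
inversion. -/
theorem SL2_induction {P : Matrix (Fin 2) (Fin 2) (Cl n) → Prop} (h_one : P 1)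
    (h_shear : ∀ W ∈ paravectors n, ∀ A, P A → P (shear W * A))
    (h_diag : ∀ u ∈ lipschitzGroup n, ∀ A, P A → P (diag u * A))
    (h_inversion : ∀ A, P A → P (inversion n * A)) {A : Matrix (Fin 2) (Fin 2) (Cl n)}
    (hA : A ∈ SL2 n) : P A := by
  obtain ⟨w, hw, hw1⟩ := exists_diag_neg_one (n := n)
  have h_unit : ∀ A ∈ SL2 n, A 0 0 ≠ 0 → P A := by
    rintro A ⟨hM, hdet, -, -, hac, hbd⟩ h0
    have hb := hM 0 1
    obtain ⟨u, hu, ha⟩ := (hM 0 0).resolve_left h0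
    rw [pdet, ← ha] at hdet
    rw [← ha] at hac
    obtain ⟨U, hU, W, hW, hb', hc, hd⟩ := exists_triangular hu hb hac hbd hdet
    -- Lower shear by `U`, times `diag u`, times upper shear by `W`. The lower shear is minus the
    -- upper shear by `-U` conjugated as `J · J` with the inversion `J`, and `diag w = -1`.
    have hA : A = diag w * (inversion n * (shear (-U) * (inversion n *
        (diag u * (shear W * 1))))) := by
      rw [Matrix.eta_fin_two A, ← ha, hb', hc, hd, hw1]
      simp [shear, diag, inversion, mul_assoc, add_comm]
    rw [hA]
    exact h_diag _ hw _ (h_inversion _ (h_shear _ (neg_mem hU) _ (h_inversion _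
      (h_diag _ hu _ (h_shear _ hW _ h_one)))))
  by_cases h0 : A 0 0 = 0
  · have hA' : A = diag w * (inversion n * (inversion n * A)) := by
      rw [hw1]
      conv_lhs => rw [Matrix.eta_fin_two A]
      conv_rhs => rw [Matrix.eta_fin_two A]
      simp [inversion]
    rw [hA']
    refine h_diag _ hw _ (h_inversion _ (h_unit _ (inversion_mul_mem_SL2 hA) ?_))
    · intro h
      have hdet := hA.2.1
      have hc : A 1 0 = 0 := by simpa [inversion, Matrix.mul_apply] using h
      simp [pdet, h0, hc, rev_zero] at hdet
  · exact h_unit A hA h0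

theorem mulVec_mem_spinors {A : Matrix (Fin 2) (Fin 2) (Cl n)} (hA : A ∈ SL2 n) :
    ∀ κ ∈ spinors n, A *ᵥ κ ∈ spinors n := by
  refine SL2_induction (P := fun A => ∀ κ ∈ spinors n, A *ᵥ κ ∈ spinors n) (by simp) ?_ ?_ ?_ hA
  · intro W hW A h κ hκ
    rw [← Matrix.mulVec_mulVec]
    exact shear_mulVec_mem_spinors hW (h κ hκ)
  · intro u hu A h κ hκ
    rw [← Matrix.mulVec_mulVec]
    exact diag_mulVec_mem_spinors hu (h κ hκ)
  · intro A h κ hκ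
    rw [← Matrix.mulVec_mulVec]
    exact inversion_mulVec_mem_spinors (h κ hκ)

theorem mul_mem_SL2 {A B : Matrix (Fin 2) (Fin 2) (Cl n)} (hA : A ∈ SL2 n) (hB : B ∈ SL2 n) :
    A * B ∈ SL2 n := by
  refine SL2_induction (P := fun A => A * B ∈ SL2 n) (by simpa) ?_ ?_ ?_ hA
  · intro W hW A h
    rw [Matrix.mul_assoc]
    exact shear_mul_mem_SL2 hW h
  · intro u hu A h
    rw [Matrix.mul_assoc]
    exact diag_mul_mem_SL2 hu h
  · intro A h
    rw [Matrix.mul_assoc]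
    exact inversion_mul_mem_SL2 h

theorem exists_inv_mul {g g' A : Matrix (Fin 2) (Fin 2) (Cl n)} (hg' : g' ∈ SL2 n)
    (h₁ : g * g' = 1) (h₂ : g' * g = 1) (hA : ∃ B ∈ SL2 n, A * B = 1 ∧ B * A = 1) :
    ∃ B ∈ SL2 n, g * A * B = 1 ∧ B * (g * A) = 1 := by
  obtain ⟨B, hB, hAB, hBA⟩ := hA
  refine ⟨B * g', mul_mem_SL2 hB hg', ?_, ?_⟩
  · rw [Matrix.mul_assoc, ← Matrix.mul_assoc A, hAB, Matrix.one_mul, h₁]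
  · rw [Matrix.mul_assoc, ← Matrix.mul_assoc g', h₂, Matrix.one_mul, hBA]

theorem exists_inv_mem_SL2 {A : Matrix (Fin 2) (Fin 2) (Cl n)} (hA : A ∈ SL2 n) :
    ∃ B ∈ SL2 n, A * B = 1 ∧ B * A = 1 := by
  refine SL2_induction (P := fun A => ∃ B ∈ SL2 n, A * B = 1 ∧ B * A = 1)
    ⟨1, one_mem_SL2, by simp⟩ ?_ ?_ ?_ hA
  · intro W hW A h
    refine exists_inv_mul (g' := shear (-W)) ?_ ?_ ?_ h
    · simpa using shear_mul_mem_SL2 (neg_mem hW) one_mem_SL2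
    all_goals simp [shear, Matrix.one_fin_two]
  · intro u hu A h
    refine exists_inv_mul (g' := diag u⁻¹) ?_ ?_ ?_ h
    · simpa using diag_mul_mem_SL2 (inv_mem hu) one_mem_SL2
    all_goals simp [diag, Matrix.one_fin_two, rev_inv_mul_rev, rev_mul_rev_inv]
  · intro A h
    obtain ⟨w, hw, hw1⟩ := exists_diag_neg_one (n := n)
    refine exists_inv_mul (g' := diag w * (inversion n * 1)) ?_ ?_ ?_ h
    · exact diag_mul_mem_SL2 hw (inversion_mul_mem_SL2 one_mem_SL2)
    all_goals simp [hw1, inversion, Matrix.one_fin_two]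

/-- The Clifford matrices as a group of invertible matrices. -/
def SL2Subgroup (n : ℕ) : Subgroup (Matrix (Fin 2) (Fin 2) (Cl n))ˣ where
  carrier := {u | u.val ∈ SL2 n}
  mul_mem' ha hb := mul_mem_SL2 ha hb
  one_mem' := one_mem_SL2
  inv_mem' {u} hu := by
    obtain ⟨B, hB, hAB, -⟩ := exists_inv_mem_SL2 hu
    rwa [Set.mem_ofPred_eq, Units.inv_eq_of_mul_eq_one_right hAB]

theorem image_SL2Subgroup :
    (fun u : (Matrix (Fin 2) (Fin 2) (Cl n))ˣ => u.val) '' (SL2Subgroup n : Set _) = SL2 n := by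
  ext A
  constructor
  · rintro ⟨u, hu, rfl⟩
    exact hu
  · intro hA
    obtain ⟨B, -, hAB, hBA⟩ := exists_inv_mem_SL2 hA
    exact ⟨⟨A, B, hAB, hBA⟩, hA, rfl⟩

/-! ### Minkowski space as paravector Hermitian matrices -/

theorem ofMat_toMat (p : Mink n) : ofMat (toMat p) = p := by
  obtain ⟨T, Z, x⟩ := p
  have h := re_sum_mul_star_paraBasis x
  simp only [ofMat, toMat, Matrix.smul_apply, Matrix.of_apply, Matrix.cons_val', Matrix.cons_val_zero,
    Matrix.cons_val_one, Matrix.cons_val_fin_one, smul_mul_assoc, map_smul, h, map_add, map_sub,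
    re_algebraMap, smul_eq_mul]
  refine Prod.ext ?_ (Prod.ext ?_ ?_)
  · simp only; ring
  · simp only; ring
  · ext k; simp only; ring

theorem ofMat_add (M N : Matrix (Fin 2) (Fin 2) (Cl n)) : ofMat (M + N) = ofMat M + ofMat N := by
  simp only [ofMat, Matrix.add_apply, add_mul, sub_eq_add_neg, neg_add, map_add, map_neg, mul_add]
  refine Prod.ext ?_ (Prod.ext ?_ ?_)
  · simp only [Prod.fst_add]; ring
  · simp only [Prod.fst_add, Prod.snd_add]; ring
  · rfl

theorem ofMat_smul (r : ℝ) (M : Matrix (Fin 2) (Fin 2) (Cl n)) : ofMat (r • M) = r • ofMat M := by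
  simp only [ofMat, Matrix.smul_apply, smul_mul_assoc, ← smul_add, ← smul_sub, map_smul]
  refine Prod.ext rfl (Prod.ext rfl ?_)
  ext k
  simp only [Prod.smul_snd, Pi.smul_apply, smul_eq_mul]
  ring

/-- The paravector Hermitian matrix with diagonal `α`, `β` and off-diagonal entry `X`. -/
def herm (α β : ℝ) (X : Cl n) : Matrix (Fin 2) (Fin 2) (Cl n) :=
  !![algebraMap ℝ (Cl n) α, X; star X, algebraMap ℝ (Cl n) β]

theorem toMat_eq_herm (p : Mink n) : toMat p =
    (1 / 2 : ℝ) • herm (p.1 + p.2.1) (p.1 - p.2.1) (∑ k, p.2.2 k • paraBasis n k) := rfl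

theorem herm_add (α β α' β' : ℝ) (X X' : Cl n) :
    herm (α + α') (β + β') (X + X') = herm α β X + herm α' β' X' := by
  ext i j
  fin_cases i <;> fin_cases j <;> simp [herm]

theorem herm_smul (r α β : ℝ) (X : Cl n) :
    herm (r * α) (r * β) (r • X) = r • herm α β X := by
  ext i j
  fin_cases i <;> fin_cases j <;> simp [herm, Algebra.algebraMap_eq_smul_one, mul_smul]

theorem toMat_add (p q : Mink n) : toMat (p + q) = toMat p + toMat q := by
  simp only [toMat_eq_herm]
  rw [← smul_add, ← herm_add, ← Finset.sum_add_distrib]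
  simp only [Prod.fst_add, Prod.snd_add, Pi.add_apply, add_smul]
  congr 2 <;> ring

theorem toMat_smul (r : ℝ) (p : Mink n) : toMat (r • p) = r • toMat p := by
  simp only [toMat_eq_herm]
  simp only [Prod.smul_fst, Prod.smul_snd, Pi.smul_apply, smul_eq_mul, ← mul_add, ← mul_sub,
    mul_smul, ← Finset.smul_sum, herm_smul]
  rw [smul_comm r]

theorem form_self_eq (p : Mink n) :
    form p p = (p.1 + p.2.1) * (p.1 - p.2.1) - ∑ k, p.2.2 k * p.2.2 k := by
  rw [form]; ring

theorem exists_toMat_eq_herm (α β : ℝ) {X : Cl n} (hX : X ∈ paravectors n) {m : ℝ}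
    (hm : X * star X = algebraMap ℝ (Cl n) m) :
    ∃ q : Mink n, toMat q = (1 / 2 : ℝ) • herm α β X ∧ form q q = α * β - m ∧
      2 * q.1 = α + β := by
  obtain ⟨x, rfl⟩ := mem_paravectors_iff_exists_sum.1 hX
  rw [sum_mul_star_sum, algebraMap_injective.eq_iff] at hm
  refine ⟨((α + β) / 2, (α - β) / 2, x), ?_, ?_, ?_⟩
  · rw [toMat_eq_herm]
    congr 2 <;> simp only <;> ring
  · rw [form_self_eq, hm]
    ring
  · simp only
    ring

/-- A matrix acts by isometries on Minkowski space that preserve the future time-like cone. -/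
def ActsOnMink (A : Matrix (Fin 2) (Fin 2) (Cl n)) : Prop :=
  ∀ p : Mink n, ∃ q : Mink n, toMat q = A * toMat p * Aᴴ ∧ form q q = form p p ∧
    (0 < form p p → 0 < p.1 → 0 < q.1)

theorem ActsOnMink.mul {A B : Matrix (Fin 2) (Fin 2) (Cl n)} (hA : ActsOnMink A)
    (hB : ActsOnMink B) : ActsOnMink (A * B) := by
  intro p
  obtain ⟨q, hq, hq', hq''⟩ := hB p
  obtain ⟨r, hr, hr', hr''⟩ := hA q
  refine ⟨r, ?_, hr'.trans hq', fun h1 h2 => hr'' (hq' ▸ h1) (hq'' h1 h2)⟩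
  rw [hr, hq, Matrix.conjTranspose_mul]
  simp only [Matrix.mul_assoc]

theorem nonneg_of_mul_star_eq {X : Cl n} (hX : X ∈ paravectors n) {m : ℝ}
    (hm : X * star X = algebraMap ℝ (Cl n) m) : 0 ≤ m := by
  obtain ⟨r, hr, h, -⟩ := exists_mul_star_of_mem hX
  rwa [algebraMap_injective (hm.symm.trans h)]

/-- The form is the determinant `αβ - |X|²` and `2T = α + β` after the factor `1/2`. On the open
future cone `αβ > |X|² ≥ 0`, so `α` and `β` have the same sign; it therefore suffices that one new
diagonal entry is positive. -/
theorem actsOnMink_of_herm {g : Matrix (Fin 2) (Fin 2) (Cl n)}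
    (h : ∀ (α β m : ℝ) (X : Cl n), X ∈ paravectors n → X * star X = algebraMap ℝ (Cl n) m →
      ∃ (α' β' m' : ℝ) (X' : Cl n), X' ∈ paravectors n ∧
        X' * star X' = algebraMap ℝ (Cl n) m' ∧ g * herm α β X * gᴴ = herm α' β' X' ∧
        α' * β' - m' = α * β - m ∧ (0 < α → 0 < β → 0 < α' ∨ 0 < β')) : ActsOnMink g := by
  intro p
  obtain ⟨α', β', m', X', hX', hm', hg, hdet, hpos⟩ := h (p.1 + p.2.1) (p.1 - p.2.1) _ _
    (mem_paravectors_iff_exists_sum.2 ⟨p.2.2, rfl⟩) (sum_mul_star_sum p.2.2)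
  obtain ⟨q, hq, hq', hq1⟩ := exists_toMat_eq_herm α' β' hX' hm'
  refine ⟨q, ?_, ?_, fun h1 h2 => ?_⟩
  · rw [hq, ← hg, toMat_eq_herm, Matrix.mul_smul, Matrix.smul_mul]
  · rw [hq', hdet, form_self_eq]
  · have h3 := Finset.sum_nonneg fun k (_ : k ∈ Finset.univ) => mul_self_nonneg (p.2.2 k)
    have h4 := nonneg_of_mul_star_eq hX' hm'
    rw [form_self_eq] at h1
    have h5 : 0 < (p.1 + p.2.1) * (p.1 - p.2.1) := by linarith
    have h6 : 0 < α' * β' := by linarith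
    have h7 : 0 < p.1 + p.2.1 ∧ 0 < p.1 - p.2.1 := by
      rcases mul_pos_iff.1 h5 with h | h
      · exact h
      · linarith
    have h8 : 0 < α' ∧ 0 < β' := by
      rcases mul_pos_iff.1 h6 with h | h
      · exact h
      · rcases hpos h7.1 h7.2 with h' | h' <;> linarith
    linarith

theorem actsOnMink_shear {W : Cl n} (hW : W ∈ paravectors n) : ActsOnMink (shear W) := by
  refine actsOnMink_of_herm fun α β m X hX hm => ?_
  obtain ⟨c, hc⟩ := exists_polar_of_mem hX hW
  obtain ⟨w, -, hw, -⟩ := exists_mul_star_of_mem hW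
  -- The entries of the product: `α' = α + (XW̄ + WX̄) + β|W|²` and `X' = X + βW`.
  refine ⟨α + c + β * w, β, m + β * c + β * β * w, X + β • W,
    add_mem hX (Submodule.smul_mem _ _ hW), ?_, ?_, by ring, fun _ h => Or.inr h⟩
  · simp only [map_add, map_mul, ← hm, ← hc, ← hw, star_add, star_real_smul, ← Algebra.smul_def]
    simp only [add_mul, mul_add, smul_mul_assoc, mul_smul_comm, smul_add]
    abel
  · rw [Algebra.algebraMap_eq_smul_one] at hc hw
    ext i j
    fin_cases i <;> fin_cases j
    · simp only [herm, Algebra.algebraMap_eq_smul_one, add_smul, mul_smul, ← hc, ← hw]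
      simp [shear, Matrix.mul_apply, add_mul]
      abel
    all_goals simp [herm, shear, Matrix.mul_apply, Algebra.algebraMap_eq_smul_one]

theorem actsOnMink_inversion : ActsOnMink (inversion n) := by
  refine actsOnMink_of_herm fun α β m X hX hm => ⟨β, α, m, -star X, neg_mem (star_mem hX), ?_, ?_,
    by ring, fun h _ => Or.inr h⟩
  · obtain ⟨r, -, hr, hr', -⟩ := exists_norm (paravectors_subset_lipschitzMonoid hX)
    simpa [← hm, hr] using hr'
  · ext i j
    fin_cases i <;> fin_cases j <;> simp [herm, inversion, Matrix.mul_apply]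

theorem actsOnMink_diag {u : (Cl n)ˣ} (hu : u ∈ lipschitzGroup n) : ActsOnMink (diag u) := by
  refine actsOnMink_of_herm fun α β m X hX hm => ?_
  obtain ⟨r, hr, h⟩ := exists_star_eq_smul_inv hu
  have h' : star (rev (↑u⁻¹ : Cl n)) = r⁻¹ • rev (u : Cl n) := by
    rw [star_rev, ← rev_star, star_inv_of_norm hr h, rev_smul]
  have h'' : rev (↑u⁻¹ : Cl n) = r⁻¹ • star (rev (u : Cl n)) := by
    rw [← star_real_smul, ← h', star_star]
  -- With `r = u ū` the diagonal scales by `r` and `r⁻¹`. The norm of `u X u*` is `r² m`, so the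
  -- factor `r⁻¹` restores `m`.
  refine ⟨α * r, β * r⁻¹, m, r⁻¹ • ((u : Cl n) * X * rev u), Submodule.smul_mem _ _ (conj_mem hu hX),
    ?_, ?_, by field_simp, fun h _ => Or.inl (by positivity)⟩
  · have h1 : rev (u : Cl n) * star (rev (u : Cl n)) = algebraMap ℝ (Cl n) r := by
      rw [star_rev, ← rev_star, ← rev_mul, h, smul_mul_assoc, Units.inv_mul, rev_smul, rev_one,
        Algebra.algebraMap_eq_smul_one]
    have h2 : ((u : Cl n) * X * rev (u : Cl n)) * star ((u : Cl n) * X * rev (u : Cl n)) =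
        algebraMap ℝ (Cl n) (r * r * m) := by
      calc _ = (u : Cl n) * X * (rev (u : Cl n) * star (rev (u : Cl n))) * star X * star (u : Cl n) := by
            simp only [star_mul, mul_assoc]
        _ = (r * r) • ((u : Cl n) * (X * star X) * ↑u⁻¹) := by
            rw [h1, h, Algebra.algebraMap_eq_smul_one]
            simp [mul_assoc, smul_smul]
        _ = _ := by
            rw [hm, ← Algebra.commutes, mul_assoc, Units.mul_inv, mul_one, map_mul _ (r * r),
              Algebra.smul_def]
    rw [star_real_smul, smul_mul_smul_comm, h2, Algebra.algebraMap_eq_smul_one,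
      Algebra.algebraMap_eq_smul_one, smul_smul]
    congr 1
    field_simp
  · ext i j
    fin_cases i <;> fin_cases j
    · simp [herm, diag, Matrix.mul_apply, h, Algebra.algebraMap_eq_smul_one, smul_smul, mul_comm]
    · simp [herm, diag, Matrix.mul_apply, h', mul_assoc]
    · simp [herm, diag, Matrix.mul_apply, h'', mul_assoc]
    · simp [herm, diag, Matrix.mul_apply, h', rev_inv_mul_rev, Algebra.algebraMap_eq_smul_one,
        smul_smul, mul_comm]

theorem actsOnMink {A : Matrix (Fin 2) (Fin 2) (Cl n)} (hA : A ∈ SL2 n) : ActsOnMink A :=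
  SL2_induction (fun p => ⟨p, by simp, rfl, fun _ h => h⟩)
    (fun _ hW _ h => (actsOnMink_shear hW).mul h) (fun _ hu _ h => (actsOnMink_diag hu).mul h)
    (fun _ h => actsOnMink_inversion.mul h) hA

/-- `ofMat` merely reads off coordinates of a matrix; nothing is lost because `A S A†` is again in
the image of `toMat`. -/
theorem toMat_act {A : Matrix (Fin 2) (Fin 2) (Cl n)} (hA : A ∈ SL2 n) (p : Mink n) :
    toMat (act A p) = A * toMat p * Aᴴ := by
  obtain ⟨q, hq, -, -⟩ := actsOnMink hA p
  rw [act, ← hq, ofMat_toMat]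

theorem act_one (p : Mink n) : act 1 p = p := by
  simp [act, ofMat_toMat]

theorem act_mul {A B : Matrix (Fin 2) (Fin 2) (Cl n)} (hB : B ∈ SL2 n)
    (p : Mink n) : act (A * B) p = act A (act B p) := by
  rw [act, act, toMat_act hB, Matrix.conjTranspose_mul]
  simp only [Matrix.mul_assoc]

/-- The action of a matrix on Minkowski space as a linear map. -/
def actLinear (A : Matrix (Fin 2) (Fin 2) (Cl n)) : Mink n →ₗ[ℝ] Mink n where
  toFun := act A
  map_add' p q := by rw [act, toMat_add, Matrix.mul_add, Matrix.add_mul, ofMat_add]; rfl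
  map_smul' r p := by rw [act, toMat_smul, Matrix.mul_smul, Matrix.smul_mul, ofMat_smul]; rfl

/-- The action of a matrix on Minkowski space as a continuous linear map. -/
def actCLM (A : Matrix (Fin 2) (Fin 2) (Cl n)) : Mink n →L[ℝ] Mink n :=
  LinearMap.toContinuousLinearMap (actLinear A)

theorem coe_actCLM (A : Matrix (Fin 2) (Fin 2) (Cl n)) : ⇑(actCLM A) = act A := rfl

theorem act_add (A : Matrix (Fin 2) (Fin 2) (Cl n)) (p q : Mink n) :
    act A (p + q) = act A p + act A q := (actCLM A).map_add p q

theorem act_smul (A : Matrix (Fin 2) (Fin 2) (Cl n)) (r : ℝ) (p : Mink n) :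
    act A (r • p) = r • act A p := (actCLM A).map_smul r p

theorem fderiv_act (A : Matrix (Fin 2) (Fin 2) (Cl n)) (p : Mink n) :
    fderiv ℝ (act A) p = actCLM A := (actCLM A).fderiv

theorem form_act_self {A : Matrix (Fin 2) (Fin 2) (Cl n)} (hA : A ∈ SL2 n) (p : Mink n) :
    form (act A p) (act A p) = form p p := by
  obtain ⟨q, hq, hq', -⟩ := actsOnMink hA p
  rw [act, ← hq, ofMat_toMat, hq']

theorem form_polar (p q : Mink n) : form (p + q) (p + q) = form p p + 2 * form p q + form q q := by
  simp only [form, Prod.fst_add, Prod.snd_add, Pi.add_apply, add_mul, mul_add,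
    Finset.sum_add_distrib]
  rw [Finset.sum_congr rfl fun k _ => mul_comm (q.2.2 k) (p.2.2 k)]
  ring

theorem form_act {A : Matrix (Fin 2) (Fin 2) (Cl n)} (hA : A ∈ SL2 n) (p q : Mink n) :
    form (act A p) (act A q) = form p q := by
  have h := form_act_self hA (p + q)
  rw [act_add, form_polar, form_polar, form_act_self hA, form_act_self hA] at h
  linarith

theorem act_mem_hyperboloid {A : Matrix (Fin 2) (Fin 2) (Cl n)} (hA : A ∈ SL2 n) {p : Mink n}
    (hp : p ∈ hyperboloid n) : act A p ∈ hyperboloid n := by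
  refine ⟨(form_act_self hA p).trans hp.1, ?_⟩
  obtain ⟨q, hq, -, hq'⟩ := actsOnMink hA p
  rw [act, ← hq, ofMat_toMat]
  exact hq' (by rw [hp.1]; exact one_pos) hp.2

theorem act_act_of_mul_eq_one {A B : Matrix (Fin 2) (Fin 2) (Cl n)} (hB : B ∈ SL2 n)
    (h : A * B = 1) (p : Mink n) : act A (act B p) = p := by
  rw [← act_mul hB, h, act_one]

theorem act_injective {A : Matrix (Fin 2) (Fin 2) (Cl n)} (hA : A ∈ SL2 n) :
    Function.Injective (act A) := by
  obtain ⟨B, -, -, hBA⟩ := exists_inv_mem_SL2 hA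
  exact Function.LeftInverse.injective (act_act_of_mul_eq_one hA hBA)

/-! ### The action on horospheres, tangent vectors and flags -/

theorem image_act_horosphere {A : Matrix (Fin 2) (Fin 2) (Cl n)} (hA : A ∈ SL2 n) (p : Mink n)
    (c : ℝ) : act A '' {x | x ∈ hyperboloid n ∧ form x p = c} =
      {x | x ∈ hyperboloid n ∧ form x (act A p) = c} := by
  obtain ⟨B, hB, hAB, hBA⟩ := exists_inv_mem_SL2 hA
  ext x
  constructor
  · rintro ⟨y, ⟨hy, hyp⟩, rfl⟩
    exact ⟨act_mem_hyperboloid hA hy, (form_act hA _ _).trans hyp⟩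
  · rintro ⟨hx, hxp⟩
    refine ⟨act B x, ⟨act_mem_hyperboloid hB hx, ?_⟩, act_act_of_mul_eq_one hB hAB x⟩
    rw [← form_act hA, act_act_of_mul_eq_one hB hAB, hxp]

theorem act_mem_tangentVectors (A : Matrix (Fin 2) (Fin 2) (Cl n)) {H : Set (Mink n)}
    {q w : Mink n} (hw : w ∈ tangentVectors H q) :
    act A w ∈ tangentVectors (act A '' H) (act A q) := by
  obtain ⟨γ, hγ, rfl, hd⟩ := hw
  exact ⟨act A ∘ γ, hγ.mono fun t ht => ⟨_, ht, rfl⟩, rfl,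
    (actCLM A).hasFDerivAt.comp_hasDerivAt 0 hd⟩

theorem act_mem_tangentVectors_iff {A : Matrix (Fin 2) (Fin 2) (Cl n)} (hA : A ∈ SL2 n)
    {H : Set (Mink n)} {q w : Mink n} :
    act A w ∈ tangentVectors (act A '' H) (act A q) ↔ w ∈ tangentVectors H q := by
  refine ⟨fun h => ?_, act_mem_tangentVectors A⟩
  obtain ⟨B, hB, hAB, hBA⟩ := exists_inv_mem_SL2 hA
  have h' := act_mem_tangentVectors B h
  rw [act_act_of_mul_eq_one hA hBA, act_act_of_mul_eq_one hA hBA, Set.image_image] at h'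
  simpa only [act_act_of_mul_eq_one hA hBA, Set.image_id'] using h'

/-- The action is linear on Minkowski space, hence equal to its own derivative. -/
theorem actLHor_eq (A : Matrix (Fin 2) (Fin 2) (Cl n)) (D : LineFieldData n) :
    actLHor A D = (act A '' D.1, fun j => Prod.map (act A) (act A) '' D.2 j) := by
  simp only [actLHor, fderiv_act, coe_actCLM]
  rfl

theorem actLHor_one (D : LineFieldData n) : actLHor 1 D = D := by
  have h : act (1 : Matrix (Fin 2) (Fin 2) (Cl n)) = id := funext act_one
  simp [actLHor_eq, h]

theorem actLHor_mul (A : Matrix (Fin 2) (Fin 2) (Cl n)) {B : Matrix (Fin 2) (Fin 2) (Cl n)}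
    (hB : B ∈ SL2 n) (D : LineFieldData n) :
    actLHor (A * B) D = actLHor A (actLHor B D) := by
  have h : act (A * B) = act A ∘ act B := funext (act_mul hB)
  simp only [actLHor_eq, h, Set.image_comp, ← Prod.map_comp_map]

theorem actLHor_mem_LHor {A : Matrix (Fin 2) (Fin 2) (Cl n)} (hA : A ∈ SL2 n)
    {D : LineFieldData n} (hD : D ∈ LHor n) : actLHor A D ∈ LHor n := by
  obtain ⟨⟨hne, p, c, hp0, hpp, hH⟩, hL, hind⟩ := hD
  obtain ⟨B, hB, hAB, hBA⟩ := exists_inv_mem_SL2 hA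
  have hBA' := act_act_of_mul_eq_one hA hBA
  rw [actLHor_eq]
  refine ⟨⟨hne.image _, act A p, c, ?_, ?_, ?_⟩, fun j => ?_, ?_⟩
  · intro h
    apply hp0
    rw [← hBA' p, h, ← coe_actCLM, map_zero]
  · rw [form_act hA, hpp]
  · rw [← image_act_horosphere hA, hH]
  · obtain ⟨X, hX, hXt, hXL⟩ := hL j
    -- The push-forward field; linearity of both actions keeps it smooth on the whole ambient space.
    refine ⟨fun x => act A (X (act B x)),
      (actCLM A).contDiff.comp (hX.comp (actCLM B).contDiff), ?_, ?_⟩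
    · rintro - ⟨q, hq, rfl⟩
      simp only [hBA']
      obtain ⟨h0, ht⟩ := hXt q hq
      refine ⟨fun h => h0 ?_, act_mem_tangentVectors A ht⟩
      rw [← hBA' (X q), h, ← coe_actCLM, map_zero]
    · simp only [hXL]
      ext ⟨q, w⟩
      constructor
      · rintro ⟨⟨q', w'⟩, ⟨hq', t, ht, h⟩, h'⟩
        simp only at hq' h
        obtain ⟨rfl, rfl⟩ := Prod.mk.inj h'
        refine ⟨⟨_, hq', rfl⟩, t, ht, ?_⟩
        simp only [hBA', h, act_smul]
      · rintro ⟨⟨q', hq', h1⟩, t, ht, h⟩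
        simp only at h1 h
        subst h1
        rw [hBA'] at h
        exact ⟨(q', t • X q'), ⟨hq', t, ht, rfl⟩, by rw [h, Prod.map_apply, act_smul]⟩
  · rintro - ⟨q, hq, rfl⟩ w hw
    have hw' : ∀ j, (q, act B (w j)) ∈ D.2 j := by
      intro j
      obtain ⟨⟨q', w'⟩, h, h'⟩ := hw j
      obtain ⟨h1, h2⟩ := Prod.mk.inj h'
      rw [← h2, hBA', ← act_injective hA h1]
      exact h
    have h := (hind q hq _ hw').map' (actLinear A) (LinearMap.ker_eq_bot.2 (act_injective hA))
    have h2 : (actLinear A) ∘ (fun j => act B (w j)) = w :=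
      funext fun j => act_act_of_mul_eq_one hB hAB (w j)
    rwa [h2] at h

theorem image_act_flag (A : Matrix (Fin 2) (Fin 2) (Cl n)) (p v : Mink n) :
    act A '' flag p v = flag (act A p) (act A v) := by
  ext w
  constructor
  · rintro ⟨-, ⟨a, b, hb, rfl⟩, rfl⟩
    exact ⟨a, b, hb, by rw [act_add, act_smul, act_smul]⟩
  · rintro ⟨a, b, hb, rfl⟩
    exact ⟨_, ⟨a, b, hb, rfl⟩, by rw [act_add, act_smul, act_smul]⟩

/-- This freedom absorbs the failure of the complement to commute with matrices. -/
theorem flag_add_smul (p v : Mink n) (c : ℝ) {s : ℝ} (hs : 0 < s) :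
    flag p (c • p + s • v) = flag p v := by
  ext w
  constructor
  · rintro ⟨a, b, hb, rfl⟩
    exact ⟨a + b * c, b * s, mul_pos hb hs, by module⟩
  · rintro ⟨a, b, hb, rfl⟩
    refine ⟨a - b / s * c, b / s, div_pos hb hs, ?_⟩
    have h : b = b / s * s := by field_simp
    conv_lhs => rw [h]
    module

theorem Phi2_act {A : Matrix (Fin 2) (Fin 2) (Cl n)} (hA : A ∈ SL2 n) (p : Mink n)
    (S : Fin n → Set (Mink n)) :
    Phi2 (act A p, fun j => act A '' S j) = actLHor A (Phi2 (p, S)) := by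
  have h : act A '' phi2 p = phi2 (act A p) := image_act_horosphere hA p 1
  rw [actLHor_eq]
  refine Prod.ext h.symm (funext fun j => ?_)
  simp only [Phi2]
  ext ⟨q, w⟩
  constructor
  · rintro ⟨hq, hw, w', hw', hww⟩
    simp only at hq hw hww
    rw [← h] at hq hw
    obtain ⟨q', hq', rfl⟩ := hq
    subst hww
    exact ⟨(q', w'), ⟨hq', (act_mem_tangentVectors_iff hA).1 hw, hw'⟩, rfl⟩
  · rintro ⟨⟨q', w'⟩, ⟨hq', hw, hw'⟩, h'⟩
    obtain ⟨rfl, rfl⟩ := Prod.mk.inj h'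
    simp only at hq' hw hw'
    refine ⟨?_, ?_, w', hw', rfl⟩
    · rw [← h]; exact ⟨_, hq', rfl⟩
    · simp only
      rw [← h]; exact act_mem_tangentVectors A hw

/-! ### The derivative of the base point map -/

/-- The derivative of the outer product `κ ↦ κ κ†` in the direction `v`. -/
def outerDeriv (κ v : Fin 2 → Cl n) : Matrix (Fin 2) (Fin 2) (Cl n) :=
  Matrix.vecMulVec κ (star v) + Matrix.vecMulVec v (star κ)

theorem outer_mulVec (A : Matrix (Fin 2) (Fin 2) (Cl n)) (κ : Fin 2 → Cl n) :
    outer (A *ᵥ κ) = A * outer κ * Aᴴ := by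
  rw [outer, outer, Matrix.star_mulVec, Matrix.mul_vecMulVec, Matrix.vecMulVec_mul]

theorem outerDeriv_mulVec (A : Matrix (Fin 2) (Fin 2) (Cl n)) (κ v : Fin 2 → Cl n) :
    outerDeriv (A *ᵥ κ) (A *ᵥ v) = A * outerDeriv κ v * Aᴴ := by
  rw [outerDeriv, outerDeriv, Matrix.star_mulVec, Matrix.star_mulVec, Matrix.mul_add,
    Matrix.add_mul, Matrix.mul_vecMulVec, Matrix.vecMulVec_mul, Matrix.mul_vecMulVec,
    Matrix.vecMulVec_mul]

theorem outer_add_smul (κ v : Fin 2 → Cl n) (t : ℝ) :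
    outer (κ + t • v) = outer κ + t • outerDeriv κ v + (t * t) • outer v := by
  ext i j
  simp only [outer, outerDeriv, Matrix.add_apply, Matrix.smul_apply, Matrix.vecMulVec_apply,
    Pi.add_apply, Pi.smul_apply, Pi.star_apply, star_add, star_real_smul, add_mul, mul_add,
    smul_mul_assoc, mul_smul_comm, smul_add, smul_smul]
  abel

theorem lineDeriv_phi1 (κ v : Fin 2 → Cl n) : lineDeriv ℝ phi1 κ v = ofMat (outerDeriv κ v) := by
  have h : (fun t : ℝ => phi1 (κ + t • v)) = fun t : ℝ =>
      phi1 κ + t • ofMat (outerDeriv κ v) + (t * t) • phi1 v := by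
    ext1 t
    rw [phi1, outer_add_smul, ofMat_add, ofMat_add, ofMat_smul, ofMat_smul]
    rfl
  rw [lineDeriv, h]
  have h1 := (hasDerivAt_id (0 : ℝ)).smul_const (ofMat (outerDeriv κ v))
  have h2 := ((hasDerivAt_id (0 : ℝ)).mul (hasDerivAt_id (0 : ℝ))).smul_const (phi1 v)
  have h3 := (h1.const_add (phi1 κ)).add h2
  refine h3.deriv.trans ?_
  simp

theorem toMat_phi1 {κ : Fin 2 → Cl n} (hκ : κ ∈ spinors n) : toMat (phi1 κ) = outer κ := by
  obtain ⟨-, hM, h⟩ := hκ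
  obtain ⟨r, -, hr, -⟩ := exists_norm (hM 0)
  obtain ⟨s, -, hs, -⟩ := exists_norm (hM 1)
  -- All entries are doubled to cancel the `1/2` in `toMat`.
  obtain ⟨m, -, hm, -⟩ := exists_mul_star_of_mem (Submodule.smul_mem _ (2 : ℝ) h)
  obtain ⟨q, hq, -, -⟩ := exists_toMat_eq_herm (2 * r) (2 * s) (Submodule.smul_mem _ (2 : ℝ) h) hm
  have h1 : outer κ = herm r s (κ 0 * star (κ 1)) := by
    ext i j
    fin_cases i <;> fin_cases j <;> simp [outer, herm, Matrix.vecMulVec_apply, hr, hs]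
  rw [herm_smul, smul_smul, ← h1] at hq
  norm_num at hq
  rw [phi1, ← hq, ofMat_toMat]

/-! ### Transitivity on spinors and equivariance -/

/-- The standard spinor `(1, 0)`. -/
def stdSpinor (n : ℕ) : Fin 2 → Cl n := ![1, 0]

theorem mulVec_pair (A : Matrix (Fin 2) (Fin 2) (Cl n)) (x y : Cl n) :
    A *ᵥ ![x, y] = fun i => A i 0 * x + A i 1 * y := by
  ext i
  simp [Matrix.mulVec, dotProduct]

theorem mulVec_stdSpinor (A : Matrix (Fin 2) (Fin 2) (Cl n)) :
    A *ᵥ stdSpinor n = fun i => A i 0 := by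
  rw [stdSpinor, mulVec_pair]
  simp

theorem stdSpinor_mem_spinors : stdSpinor n ∈ spinors n := by
  have h := (mem_SL2_iff.1 (one_mem_SL2 (n := n))).1
  rwa [← mulVec_stdSpinor, Matrix.one_mulVec] at h

theorem smul_mem_spinors {r : ℝ} (hr : r ≠ 0) {κ : Fin 2 → Cl n} (hκ : κ ∈ spinors n) :
    r • κ ∈ spinors n := by
  obtain ⟨h0, hM, h⟩ := hκ
  refine ⟨smul_ne_zero hr h0, fun i => smul_mem_lipschitzMonoid r (hM i), ?_⟩
  simp only [Pi.smul_apply, star_real_smul, smul_mul_smul_comm]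
  exact Submodule.smul_mem _ _ h

theorem compl_mem_spinors {κ : Fin 2 → Cl n} (hκ : κ ∈ spinors n) : compl κ ∈ spinors n := by
  obtain ⟨h0, hM, h⟩ := hκ
  refine ⟨fun h' => h0 ?_, fun i => ?_, ?_⟩
  · have h1 : CliffordAlgebra.involute (κ 1) = 0 := congr_fun h' 0
    have h2 : -CliffordAlgebra.involute (κ 0) = 0 := congr_fun h' 1
    have h3 := CliffordAlgebra.involute_involute (κ 1)
    have h4 := CliffordAlgebra.involute_involute (κ 0)
    rw [h1, map_zero] at h3
    rw [neg_eq_zero.1 h2, map_zero] at h4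
    ext i
    fin_cases i
    · exact h4.symm
    · exact h3.symm
  · fin_cases i
    · exact involute_mem_lipschitzMonoid (hM 1)
    · exact neg_mem_lipschitzMonoid (involute_mem_lipschitzMonoid (hM 0))
  · have h1 : compl κ 0 * star (compl κ 1) = -CliffordAlgebra.involute (star (κ 0 * star (κ 1))) := by
      simp [compl, involute_star, star_involute]
    rw [h1]
    exact neg_mem (involute_mem (star_mem h))

/-- Reversing `x̄ x = |x|²` gives `x* x' = |x|²`, so the pairing is `-(|ξ|² + |η|²)`, nonzero as `κ
≠ 0`. -/
theorem exists_pairing_compl {κ : Fin 2 → Cl n} (hκ : κ ∈ spinors n) :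
    ∃ N : ℝ, 0 < N ∧ pairing κ (compl κ) = -algebraMap ℝ (Cl n) N := by
  have h1 : ∀ x ∈ lipschitzMonoid n, ∃ r : ℝ, 0 ≤ r ∧
      rev x * CliffordAlgebra.involute x = algebraMap ℝ (Cl n) r ∧ (x ≠ 0 → 0 < r) := by
    intro x hx
    obtain ⟨r, hr, -, h, hpos⟩ := exists_norm hx
    refine ⟨r, hr, ?_, hpos⟩
    rw [← rev_star, ← rev_mul, h, rev_of_mem (algebraMap_mem_paravectors r)]
  obtain ⟨h0, hM, -⟩ := hκ
  obtain ⟨r, hr, hr1, hr2⟩ := h1 _ (hM 0)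
  obtain ⟨s, hs, hs1, hs2⟩ := h1 _ (hM 1)
  refine ⟨r + s, ?_, ?_⟩
  · by_contra h
    apply h0
    ext i
    fin_cases i
    · by_contra h'
      have := hr2 h'
      linarith
    · by_contra h'
      have := hs2 h'
      linarith
  · simp only [pairing, compl, Matrix.cons_val_zero, Matrix.cons_val_one, mul_neg, hr1, hs1,
      map_add]
    abel

/-- Every spinor and a multiple of its complement are the columns of a Clifford matrix. -/
theorem exists_frame {κ : Fin 2 → Cl n} (hκ : κ ∈ spinors n) :
    ∃ F ∈ SL2 n, ∃ N : ℝ, 0 < N ∧ (∀ i, F i 0 = κ i) ∧ ∀ i, compl κ i = -(N • F i 1) := by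
  obtain ⟨N, hN, h⟩ := exists_pairing_compl hκ
  refine ⟨Matrix.of fun i => ![κ i, (-N⁻¹) • compl κ i], ?_, N, hN, fun i => rfl, fun i => ?_⟩
  · refine mem_SL2_iff.2 ⟨hκ, smul_mem_spinors (neg_ne_zero.2 (inv_ne_zero hN.ne'))
      (compl_mem_spinors hκ), ?_⟩
    have h1 : (-N⁻¹) • pairing κ (compl κ) = 1 := by
      rw [h, Algebra.algebraMap_eq_smul_one, smul_neg, neg_smul, neg_neg, inv_smul_smul₀ hN.ne']
    rw [← h1, pairing, smul_sub, ← mul_smul_comm, ← mul_smul_comm]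
    rfl
  · simp [hN.ne']

theorem exists_eq_mulVec_stdSpinor {κ : Fin 2 → Cl n} (hκ : κ ∈ spinors n) :
    ∃ F ∈ SL2 n, F *ᵥ stdSpinor n = κ := by
  obtain ⟨F, hF, -, -, h, -⟩ := exists_frame hκ
  exact ⟨F, hF, by rw [mulVec_stdSpinor]; exact funext h⟩

/-- The second column of a Clifford matrix is determined by the first up to a paravector. -/
theorem exists_snd_column_eq {A B : Matrix (Fin 2) (Fin 2) (Cl n)} (hA : A ∈ SL2 n)
    (hB : B ∈ SL2 n) (h : ∀ i, A i 0 = B i 0) :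
    ∃ W ∈ paravectors n, ∀ i, B i 1 = A i 0 * W + A i 1 := by
  -- `A⁻¹ B` fixes `(1, 0)`; pseudo-determinant `1` then makes its lower right entry `1`, and the
  -- condition on `d* b` makes its upper right entry a paravector, so it is a shear.
  obtain ⟨C, hC, hAC, hCA⟩ := exists_inv_mem_SL2 hA
  have hG := mul_mem_SL2 hC hB
  have h1 : (C * B) *ᵥ stdSpinor n = stdSpinor n := by
    have h2 : B *ᵥ stdSpinor n = A *ᵥ stdSpinor n := by
      rw [mulVec_stdSpinor, mulVec_stdSpinor]
      exact funext fun i => (h i).symm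
    rw [← Matrix.mulVec_mulVec, h2, Matrix.mulVec_mulVec, hCA, Matrix.one_mulVec]
  rw [mulVec_stdSpinor] at h1
  have h00 : (C * B) 0 0 = 1 := congr_fun h1 0
  have h10 : (C * B) 1 0 = 0 := congr_fun h1 1
  obtain ⟨-, hdet, -, -, -, hbd⟩ := hG
  rw [pdet, h00, h10, rev_one, rev_zero, one_mul, zero_mul, sub_zero] at hdet
  rw [hdet, rev_one, one_mul] at hbd
  refine ⟨_, hbd, fun i => ?_⟩
  have h3 : B = A * (C * B) := by rw [← Matrix.mul_assoc, hAC, Matrix.one_mul]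
  conv_lhs => rw [h3]
  rw [Matrix.mul_apply, Fin.sum_univ_two, hdet, mul_one]

theorem star_gen (j : Fin n) : star (gen n j) = -gen n j := CliffordAlgebra.star_ι _

theorem gen_mem_paravectors (j : Fin n) : gen n j ∈ paravectors n := ι_mem_paravectors _

theorem outerDeriv_stdSpinor (x y : Cl n) :
    outerDeriv (stdSpinor n) ![x, y] = !![star x + x, star y; y, 0] := by
  ext i j
  simp only [outerDeriv, Matrix.add_apply, Matrix.vecMulVec_apply, Pi.star_apply]
  fin_cases i <;> fin_cases j <;> simp [stdSpinor]

theorem outer_stdSpinor : outer (stdSpinor n) = !![1, 0; 0, 0] := by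
  ext i j
  simp only [outer, Matrix.vecMulVec_apply, Pi.star_apply]
  fin_cases i <;> fin_cases j <;> simp [stdSpinor]

/-- The base point of the standard spinor. -/
def stdPoint (n : ℕ) : Mink n := (1, 1, 0)

/-- The flag vectors of the standard spinor. -/
def stdVector (j : Fin n) : Mink n := (0, 0, Pi.single j.succ 2)

theorem toMat_stdPoint : toMat (stdPoint n) = outer (stdSpinor n) := by
  rw [toMat, outer_stdSpinor]
  ext i j
  fin_cases i <;> fin_cases j <;>
    simp [stdPoint, Algebra.algebraMap_eq_smul_one, smul_smul, one_add_one_eq_two]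

theorem toMat_stdVector (j : Fin n) : toMat (stdVector j) = !![0, gen n j; -gen n j, 0] := by
  have h : ∑ k, (stdVector j).2.2 k • paraBasis n k = (2 : ℝ) • gen n j := by
    simp [stdVector, Pi.single_apply, paraBasis]
  rw [toMat, h]
  ext i k
  fin_cases i <;> fin_cases k <;> simp [stdVector, star_gen, smul_smul]

/-- The derivative of the outer product at the first column of a Clifford matrix in the
direction of its complement times a generator. -/
theorem exists_lineDeriv_phi1 {F : Matrix (Fin 2) (Fin 2) (Cl n)} (hF : F ∈ SL2 n) (j : Fin n) :
    ∃ c N : ℝ, 0 < N ∧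
      lineDeriv ℝ phi1 (F *ᵥ stdSpinor n) (mulRight (compl (F *ᵥ stdSpinor n)) (gen n j)) =
        c • act F (stdPoint n) + N • act F (stdVector j) := by
  -- `G` has the complement, divided by `-N`, as second column and shares its first column with `F`.
  obtain ⟨G, hG, N, hN, hG0, hG1⟩ := exists_frame (mulVec_mem_spinors hF _ stdSpinor_mem_spinors)
  obtain ⟨W, hW, hW1⟩ := exists_snd_column_eq hF hG fun i => by rw [hG0, mulVec_stdSpinor]
  obtain ⟨c, hc⟩ := exists_polar_of_mem hW (gen_mem_paravectors j)
  have hz : mulRight (compl (F *ᵥ stdSpinor n)) (gen n j) =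
      F *ᵥ ![-(N • (W * gen n j)), -(N • gen n j)] := by
    rw [mulVec_pair]
    ext i
    rw [mulRight, hG1, hW1]
    simp [add_mul, mul_assoc, add_comm]
  -- The upper left entry is `N (W ī_j + i_j W̄) = N c`, a real multiple of the base point; the
  -- off-diagonal part is `N` times the standard flag vector.
  have hd : outerDeriv (stdSpinor n) ![-(N • (W * gen n j)), -(N • gen n j)] =
      (N * c) • toMat (stdPoint n) + N • toMat (stdVector j) := by
    rw [outerDeriv_stdSpinor, toMat_stdPoint, outer_stdSpinor, toMat_stdVector]
    rw [star_gen, Algebra.algebraMap_eq_smul_one] at hc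
    ext i k
    fin_cases i <;> fin_cases k
    · simp [mul_smul, ← hc, star_gen, add_comm]
    all_goals simp [star_gen]
  refine ⟨N * c, N, hN, ?_⟩
  rw [hz, lineDeriv_phi1, outerDeriv_mulVec, hd, act, act, ← ofMat_smul, ← ofMat_smul,
    ← ofMat_add]
  simp only [Matrix.mul_add, Matrix.add_mul, Matrix.mul_smul, Matrix.smul_mul]

/-- The decorated horosphere of the standard spinor. -/
def stdDecorated (n : ℕ) : LineFieldData n :=
  Phi2 (stdPoint n, fun j => flag (stdPoint n) (stdVector j))

/-- The derivative is `F` applied to a positive multiple of the standard flag vector plus a multiple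
of the base point, which spans the same oriented flag. -/
theorem Phi_mulVec_stdSpinor {F : Matrix (Fin 2) (Fin 2) (Cl n)} (hF : F ∈ SL2 n) :
    Phi (F *ᵥ stdSpinor n) = actLHor F (stdDecorated n) := by
  rw [stdDecorated, ← Phi2_act hF, Phi, Phi1]
  have h : phi1 (F *ᵥ stdSpinor n) = act F (stdPoint n) := by
    rw [phi1, outer_mulVec, act, toMat_stdPoint]
  congr 2
  ext1 j
  obtain ⟨c, N, hN, h1⟩ := exists_lineDeriv_phi1 hF j
  rw [h, h1, flag_add_smul _ _ _ hN, image_act_flag]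

theorem Phi_mulVec {A : Matrix (Fin 2) (Fin 2) (Cl n)} (hA : A ∈ SL2 n) {κ : Fin 2 → Cl n}
    (hκ : κ ∈ spinors n) : Phi (A *ᵥ κ) = actLHor A (Phi κ) := by
  obtain ⟨F, hF, rfl⟩ := exists_eq_mulVec_stdSpinor hκ
  rw [Matrix.mulVec_mulVec, Phi_mulVec_stdSpinor (mul_mem_SL2 hA hF), Phi_mulVec_stdSpinor hF,
    actLHor_mul A hF]

/-! ### The horosphere of the standard spinor -/

theorem form_stdPoint (x : Mink n) : form x (stdPoint n) = x.1 - x.2.1 := by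
  simp [form, stdPoint]

/-- The point of the standard horosphere with given paravector coordinates. -/
def horoPoint (x : Fin (n + 1) → ℝ) : Mink n :=
  (1 + (∑ k, x k * x k) / 2, (∑ k, x k * x k) / 2, x)

/-- Since `T - Z = 1`, the equation of the hyperboloid becomes `T + Z = 1 + |x|²`: the horosphere is
a paraboloid parametrised by `x`, and `T > 0` is automatic. -/
theorem mem_phi2_stdPoint_iff {q : Mink n} : q ∈ phi2 (stdPoint n) ↔ q = horoPoint q.2.2 := by
  obtain ⟨T, Z, x⟩ := q
  have h0 : 0 ≤ ∑ k, x k * x k := Finset.sum_nonneg fun k _ => mul_self_nonneg (x k)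
  simp only [phi2, hyperboloid, Set.mem_ofPred_eq, form_stdPoint, horoPoint, Prod.mk.injEq,
    and_true]
  simp only [form]
  generalize ∑ k, x k * x k = s at h0
  constructor
  · rintro ⟨⟨h1, -⟩, h2⟩
    obtain rfl : T = Z + 1 := by linarith
    constructor <;> linarith
  · rintro ⟨rfl, rfl⟩
    refine ⟨⟨by ring, by linarith⟩, by ring⟩

/-- The vector fields directing the line fields of the standard spinor. -/
def stdField (j : Fin n) (q : Mink n) : Mink n :=
  (q.2.2 j.succ, q.2.2 j.succ, Pi.single j.succ 1)

theorem stdField_mem_tangentVectors (j : Fin n) {q : Mink n} (hq : q ∈ phi2 (stdPoint n)) :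
    stdField j q ∈ tangentVectors (phi2 (stdPoint n)) q := by
  obtain ⟨T, Z, x⟩ := q
  refine ⟨fun t => horoPoint (x + t • Pi.single j.succ 1),
    Filter.Eventually.of_forall fun t => mem_phi2_stdPoint_iff.2 rfl, ?_, ?_⟩
  · simp only [zero_smul, add_zero]
    exact (mem_phi2_stdPoint_iff.1 hq).symm
  · have h1 : HasDerivAt (fun t : ℝ => x + t • (Pi.single j.succ 1 : Fin (n + 1) → ℝ))
        (Pi.single j.succ 1) 0 := by
      simpa using ((hasDerivAt_id (0 : ℝ)).smul_const
        (Pi.single j.succ 1 : Fin (n + 1) → ℝ)).const_add x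
    have h2 : HasDerivAt (fun t : ℝ => (∑ k, (x + t • (Pi.single j.succ 1 : Fin (n + 1) → ℝ)) k *
        (x + t • (Pi.single j.succ 1 : Fin (n + 1) → ℝ)) k) / 2) (x j.succ) 0 := by
      have h3 := fun k => hasDerivAt_pi.1 h1 k
      have h4 := (HasDerivAt.fun_sum (u := Finset.univ) fun k _ => (h3 k).mul (h3 k)).div_const 2
      refine h4.congr_deriv ?_
      simp [Pi.single_apply, Finset.sum_add_distrib]
    exact (h2.const_add 1).prodMk (h2.prodMk h1)

/-- Along a curve in the paraboloid `Z = |x|²/2` and `T = 1 + |x|²/2`; differentiate both. -/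
theorem form_eq_zero_of_mem_tangentVectors {q w : Mink n}
    (hw : w ∈ tangentVectors (phi2 (stdPoint n)) q) :
    w.1 = w.2.1 ∧ w.1 = ∑ k, q.2.2 k * w.2.2 k := by
  obtain ⟨γ, hγ, rfl, hd⟩ := hw
  have h1 : HasDerivAt (fun t => (γ t).1) w.1 0 :=
    (ContinuousLinearMap.fst ℝ ℝ (ℝ × (Fin (n + 1) → ℝ))).hasFDerivAt.comp_hasDerivAt 0 hd
  have h2 : HasDerivAt (fun t => (γ t).2.1) w.2.1 0 :=
    ((ContinuousLinearMap.fst ℝ ℝ (Fin (n + 1) → ℝ)).comp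
      (ContinuousLinearMap.snd ℝ ℝ (ℝ × (Fin (n + 1) → ℝ)))).hasFDerivAt.comp_hasDerivAt 0 hd
  have h3 := fun k => hasDerivAt_pi.1 hd.snd.snd k
  have h4 := (HasDerivAt.fun_sum (u := Finset.univ) fun k _ => (h3 k).mul (h3 k)).div_const 2
  have h5 : (fun t => (γ t).2.1) =ᶠ[𝓝 0] fun t => (∑ k, (γ t).2.2 k * (γ t).2.2 k) / 2 :=
    hγ.mono fun t ht => congr_arg (fun q => q.2.1) (mem_phi2_stdPoint_iff.1 ht)
  have h6 : (fun t => (γ t).1) =ᶠ[𝓝 0] fun t => 1 + (∑ k, (γ t).2.2 k * (γ t).2.2 k) / 2 :=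
    hγ.mono fun t ht => congr_arg (fun q => q.1) (mem_phi2_stdPoint_iff.1 ht)
  have h7 := h2.unique (h4.congr_of_eventuallyEq h5)
  have h8 := h1.unique ((h4.const_add 1).congr_of_eventuallyEq h6)
  refine ⟨h8.trans h7.symm, h8.trans ?_⟩
  rw [div_eq_iff two_ne_zero, Finset.sum_mul]
  exact Finset.sum_congr rfl fun k _ => by ring

/-- A flag vector has the form `(a, a, 2b e_j)` with `b > 0`, and tangency forces `a = 2b x_j`,
leaving exactly one open ray. -/
theorem stdDecorated_snd (j : Fin n) : (stdDecorated n).2 j =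
    {x | x.1 ∈ phi2 (stdPoint n) ∧ ∃ t : ℝ, 0 < t ∧ x.2 = t • stdField j x.1} := by
  ext ⟨q, w⟩
  refine and_congr_right fun hq => ?_
  simp only at hq
  constructor
  · rintro ⟨hw, a, b, hb, h⟩
    simp only at hw h
    have h1 := (form_eq_zero_of_mem_tangentVectors hw).2
    refine ⟨2 * b, by positivity, ?_⟩
    have ha : a = 2 * b * q.2.2 j.succ := by
      simp [h, stdPoint, stdVector, Pi.single_apply] at h1
      linarith
    simp only [h, ha]
    refine Prod.ext ?_ (Prod.ext ?_ ?_)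
    · simp [stdPoint, stdVector, stdField]
    · simp [stdPoint, stdVector, stdField]
    · ext k
      simp [stdPoint, stdVector, stdField, Pi.single_apply, mul_comm]
  · rintro ⟨t, ht, h⟩
    simp only at h
    subst h
    refine ⟨?_, t * q.2.2 j.succ, t / 2, by positivity, ?_⟩
    -- Tangent vectors are velocities of curves, so scaling by `t` is done by running the curve at
    -- speed `t`.
    · obtain ⟨γ, hγ, hγ0, hd⟩ := stdField_mem_tangentVectors j hq
      refine ⟨fun s => γ (t * s), ?_, by simpa using hγ0, ?_⟩
      · have hc : Filter.Tendsto (fun s : ℝ => t * s) (𝓝 0) (𝓝 0) := by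
          simpa using (continuous_const_mul t).tendsto 0
        exact hc.eventually hγ
      · have hd' : HasDerivAt γ (stdField j q) (t * 0) := by rwa [mul_zero]
        have h1 : HasDerivAt (fun s : ℝ => t * s) t 0 := by
          simpa using (hasDerivAt_id (0 : ℝ)).const_mul t
        exact hd'.scomp 0 h1
    · simp only
      refine Prod.ext ?_ (Prod.ext ?_ ?_)
      · simp [stdPoint, stdVector, stdField]
      · simp [stdPoint, stdVector, stdField]
      · ext k
        simp [stdPoint, stdVector, stdField, Pi.single_apply]

theorem stdDecorated_mem_LHor : stdDecorated n ∈ LHor n := by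
  refine ⟨⟨⟨horoPoint 0, mem_phi2_stdPoint_iff.2 rfl⟩, stdPoint n, 1, ?_, ?_, rfl⟩, fun j => ?_, ?_⟩
  · intro h
    exact one_ne_zero (congr_arg Prod.fst h)
  · rw [form_stdPoint]
    exact sub_self _
  · refine ⟨stdField j, ?_, fun q hq => ⟨fun h => ?_, stdField_mem_tangentVectors j hq⟩,
      stdDecorated_snd j⟩
    · have h1 : ContDiff ℝ ∞ fun q : Mink n => q.2.2 j.succ :=
        (contDiff_apply ℝ ℝ j.succ).comp (contDiff_snd.comp contDiff_snd)
      exact h1.prodMk (h1.prodMk contDiff_const)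
    · have h1 : (Pi.single j.succ 1 : Fin (n + 1) → ℝ) = 0 := congr_arg (fun q => q.2.2) h
      simp at h1
  · intro q hq w hw
    simp only [stdDecorated_snd] at hw
    choose t ht hw using fun j => (hw j).2
    simp only at hw
    rw [Fintype.linearIndependent_iff]
    intro g hg j
    -- Only the `j`-th field has a nonzero coordinate `X_j`; the shift `succ` skips the real
    -- coordinate `X_0`.
    have h1 := congr_arg (fun p : Mink n => p.2.2 j.succ) hg
    simp only [hw, Prod.snd_sum, Finset.sum_apply, Prod.smul_snd, Pi.smul_apply, stdField] at h1
    simpa [Pi.single_apply, (ht _).ne'] using h1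

theorem Phi_mem_LHor {κ : Fin 2 → Cl n} (hκ : κ ∈ spinors n) : Phi κ ∈ LHor n := by
  obtain ⟨F, hF, rfl⟩ := exists_eq_mulVec_stdSpinor hκ
  rw [Phi_mulVec_stdSpinor hF]
  exact actLHor_mem_LHor hF stdDecorated_mem_LHor

end LipSpinor

end

theorem mainTheorem8 (n : ℕ) :
    -- the Clifford matrices form a group
    (∃ G : Subgroup (Matrix (Fin 2) (Fin 2) (LipSpinor.Cl n))ˣ,
      (fun u : (Matrix (Fin 2) (Fin 2) (LipSpinor.Cl n))ˣ => u.val) '' (G : Set _) =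
        LipSpinor.SL2 n) ∧
    -- which acts on spinors by matrix multiplication,
    (∀ A ∈ LipSpinor.SL2 n,
      Set.MapsTo (fun κ => A *ᵥ κ) (LipSpinor.spinors n) (LipSpinor.spinors n)) ∧
    -- on Minkowski space by conjugation, preserving hyperbolic space,
    (∀ A ∈ LipSpinor.SL2 n, ∀ p : LipSpinor.Mink n,
      LipSpinor.toMat (LipSpinor.act A p) = A * LipSpinor.toMat p * Aᴴ) ∧
    (∀ A ∈ LipSpinor.SL2 n,
      Set.MapsTo (LipSpinor.act A) (LipSpinor.hyperboloid n) (LipSpinor.hyperboloid n)) ∧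
    -- and hence on horospheres carrying line fields;
    (∀ A ∈ LipSpinor.SL2 n,
      Set.MapsTo (LipSpinor.actLHor A) (LipSpinor.LHor n) (LipSpinor.LHor n)) ∧
    (∀ D ∈ LipSpinor.LHor n, LipSpinor.actLHor 1 D = D) ∧
    (∀ A ∈ LipSpinor.SL2 n, ∀ B ∈ LipSpinor.SL2 n, ∀ D ∈ LipSpinor.LHor n,
      LipSpinor.actLHor (A * B) D = LipSpinor.actLHor A (LipSpinor.actLHor B D)) ∧
    -- the map from spinors to horospheres carrying line fields is well defined
    (∀ κ ∈ LipSpinor.spinors n,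
      LipSpinor.toMat (LipSpinor.phi1 κ) = LipSpinor.outer κ) ∧
    Set.MapsTo LipSpinor.Phi (LipSpinor.spinors n) (LipSpinor.LHor n) ∧
    -- and equivariant.
    (∀ A ∈ LipSpinor.SL2 n, ∀ κ ∈ LipSpinor.spinors n,
      LipSpinor.Phi (A *ᵥ κ) = LipSpinor.actLHor A (LipSpinor.Phi κ)) :=
  ⟨⟨LipSpinor.SL2Subgroup n, LipSpinor.image_SL2Subgroup⟩,
    fun _ hA _ hκ => LipSpinor.mulVec_mem_spinors hA _ hκ,
    fun _ hA p => LipSpinor.toMat_act hA p,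
    fun _ hA _ hp => LipSpinor.act_mem_hyperboloid hA hp,
    fun _ hA _ hD => LipSpinor.actLHor_mem_LHor hA hD,
    fun D _ => LipSpinor.actLHor_one D,
    fun A _ _ hB D _ => LipSpinor.actLHor_mul A hB D,
    fun _ hκ => LipSpinor.toMat_phi1 hκ,
    fun _ hκ => LipSpinor.Phi_mem_LHor hκ,
    fun _ hA _ hκ => LipSpinor.Phi_mulVec hA hκ⟩
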